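/- Let $M$ be a smooth manifold of dimension $n\ge 3$ with a Finsler metric $F\colon TM\to[0,\infty)$: $F$ is continuous, smooth on the complement of the zero section, satisfies $F(tv)=tF(v)$ for $t>0$, and, with $E=\frac12F^2$, the matrix $g_{ij}=\frac{\partial^2E}{\partial y^i\partial y^j}$ is positive definite at every nonzero tangent vector. Here $(x^i,y^i)$ are the coordinates of $TM$ induced by local coordinates $(u^i)$ of $M$, $(g^{ij})$ is the inverse of $(g_{ij})$, and sums over repeated indices are understood. Let $$G^l=\tfrac12g^{lm}\Big(y^k\frac{\partial^2E}{\partial y^m\partial x^k}-\frac{\partial E}{\partial x^m}\Big),\qquad P^l_{ijk}=-\frac{\partial^3G^l}{\partial y^i\partial y^j\partial y^k}$$ be the geodesic spray coefficients and the mixed curvature of the Berwald connection of $F$. Let $\alpha\colon M\to\mathbb R$ be a smooth function, $\alpha_l=\frac{\partial\alpha}{\partial u^l}$, let $\tilde P^l_{ijk}$ be the mixed curvature of the conformally changed metric $\tilde F=e^{\alpha}F$, and put $$X^l=g^{lm}\alpha_m,\qquad X^l_s=\frac{\partial X^l}{\partial y^s}.$$ Let $p\in M$ be a point with $d_p\alpha\ne0$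 such that (i) the indicatrix $\{v\in T_pM: F(v)=1\}$, with the Riemannian metric induced by $g_{ij}$ on $T_pM\setminus\{0\}$, has positive sectional curvature, and (ii) $\tilde P^l_{ijk}\alpha_l=P^l_{ijk}\alpha_l$ at all nonzero $v\in T_pM$, for all $i,j,k$. Then both functions $$v\mapsto (X^l\alpha_l)(v)\qquad\text{and}\qquad v\mapsto F(v)\,(X^l_sX^s\alpha_l)(v)$$ are constant on the set of nonzero vectors of the hyperplane $T_pN=\{v\in T_pM: v(\alpha)=0\}$. -/

import Mathlib

open scoped Manifold ContDiff

noncomputable section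

namespace FinslerConformal

/-- Coordinate space `ℝⁿ`; it is also the model space of the manifolds below. -/
abbrev Coord (n : ℕ) : Type := EuclideanSpace ℝ (Fin n)

/-- The partial derivative `∂f/∂uⁱ` at `u`. -/
def pd {n : ℕ} (f : Coord n → ℝ) (i : Fin n) (u : Coord n) : ℝ :=
  fderiv ℝ f u (EuclideanSpace.single i 1)

/-! ### Sectional curvature of a metric tensor given in coordinates -/

section Curvature

variable {m : ℕ}

/-- Christoffel symbols `Γᶜₐᵦ` of the metric `h`. -/
def christoffel (h : Coord m → Matrix (Fin m) (Fin m) ℝ) (c a b : Fin m) (u : Coord m) : ℝ :=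
  (1 / 2) * ∑ d, (h u)⁻¹ c d *
    (pd (fun u' => h u' b d) a u + pd (fun u' => h u' a d) b u - pd (fun u' => h u' a b) d u)

/-- The components of the curvature tensor: `R(∂ₐ, ∂ᵦ)∂_c = ∑ d, (riemann h d c a b) ∂_d`, where
`R(X, Y)Z = ∇_X ∇_Y Z - ∇_Y ∇_X Z - ∇_[X,Y] Z` for the Levi-Civita connection of `h`. -/
def riemann (h : Coord m → Matrix (Fin m) (Fin m) ℝ) (d c a b : Fin m) (u : Coord m) : ℝ :=
  pd (christoffel h d b c) a u - pd (christoffel h d a c) b u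
    + ∑ e, (christoffel h d a e u * christoffel h e b c u
      - christoffel h d b e u * christoffel h e a c u)

/-- The scalar product `h_u(ξ, ζ)`. -/
def metricProd (h : Coord m → Matrix (Fin m) (Fin m) ℝ) (u ξ ζ : Coord m) : ℝ :=
  ∑ a, ∑ b, h u a b * ξ a * ζ b

/-- The sectional curvature `h(R(ξ, ζ)ζ, ξ) / (h(ξ, ξ) h(ζ, ζ) - h(ξ, ζ)²)` of the plane spanned by
the linearly independent vectors `ξ`, `ζ` at `u`. -/
def sectionalCurvature (h : Coord m → Matrix (Fin m) (Fin m) ℝ) (u ξ ζ : Coord m) : ℝ :=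
  (∑ a, ∑ b, ∑ c, ∑ d, ∑ e, h u d e * riemann h d c a b u * ξ a * ζ b * ζ c * ξ e) /
    (metricProd h u ξ ξ * metricProd h u ζ ζ - metricProd h u ξ ζ ^ 2)

end Curvature

/-! ### A single tangent space: energy, Riemann-Finsler metric, indicatrix -/

section Vertical

variable {n : ℕ}

/-- The energy `E = (1/2) F²` of a function `L` on a tangent space. -/
def energy (L : Coord n → ℝ) (y : Coord n) : ℝ := (1 / 2) * L y ^ 2

/-- The Riemann-Finsler metric `g_ij = ∂²E/∂yⁱ∂yʲ`. -/
def gMatrix (L : Coord n → ℝ) (y : Coord n) : Matrix (Fin n) (Fin n) ℝ :=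
  Matrix.of fun i j => pd (pd (energy L) i) j y

/-- `r` is a smooth regular parametrization, over the open set `U ⊆ ℝⁿ⁻¹`, of a piece of the
indicatrix hypersurface `{y | L y = 1}`. -/
structure IsIndicatrixParam (L : Coord n → ℝ) (U : Set (Coord (n - 1)))
    (r : Coord (n - 1) → Coord n) : Prop where
  isOpen : IsOpen U
  smooth : ContDiffOn ℝ ∞ r U
  immersion : ∀ u ∈ U, Function.Injective (fderiv ℝ r u)
  mem : ∀ u ∈ U, L (r u) = 1

/-- The Riemannian metric induced by `g_ij` on a parametrized piece of the indicatrix. -/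
def inducedMetric (L : Coord n → ℝ) (r : Coord (n - 1) → Coord n) (u : Coord (n - 1)) :
    Matrix (Fin (n - 1)) (Fin (n - 1)) ℝ :=
  Matrix.of fun a b => ∑ i, ∑ j, gMatrix L (r u) i j *
    pd (fun u' => r u' i) a u * pd (fun u' => r u' j) b u

/-- The indicatrix hypersurface `{y | L y = 1}`, as a Riemannian submanifold of `ℝⁿ \ {0}` with the
metric `g_ij`, has positive sectional curvature at all of its points. -/
def IndicatrixPositivelyCurved (L : Coord n → ℝ) : Prop :=
  ∀ (U : Set (Coord (n - 1))) (r : Coord (n - 1) → Coord n), IsIndicatrixParam L U r →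
    ∀ u ∈ U, ∀ ξ ζ : Coord (n - 1), LinearIndependent ℝ ![ξ, ζ] →
      0 < sectionalCurvature (inducedMetric L r) u ξ ζ

/-- `Xˡ = gˡᵐ αₘ`, the components of the gradient-type vector field of the covector `a = (αₘ)`. -/
def gradX (L : Coord n → ℝ) (a : Fin n → ℝ) (l : Fin n) (y : Coord n) : ℝ :=
  ∑ k, (gMatrix L y)⁻¹ l k * a k

/-- `Xˡ αₗ`. -/
def gradSq (L : Coord n → ℝ) (a : Fin n → ℝ) (y : Coord n) : ℝ :=
  ∑ l, gradX L a l y * a l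

/-- `Xˡₛ Xˢ αₗ`, where `Xˡₛ = ∂Xˡ/∂yˢ`. -/
def gradDeriv (L : Coord n → ℝ) (a : Fin n → ℝ) (y : Coord n) : ℝ :=
  ∑ l, ∑ s, pd (gradX L a l) s y * gradX L a s y * a l

end Vertical

/-! ### Spray coefficients and mixed curvature in induced coordinates `(x, y)` -/

section Spray

variable {n : ℕ}

/-- Geodesic spray coefficients
`Gˡ = (1/2) gˡᵐ (yᵏ ∂²E/∂yᵐ∂xᵏ - ∂E/∂xᵐ)` of the function `K (x, y)`. -/
def spray (K : Coord n → Coord n → ℝ) (l : Fin n) (x y : Coord n) : ℝ :=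
  (1 / 2) * ∑ m, (gMatrix (K x) y)⁻¹ l m *
    ((∑ k, y k * pd (fun y' => pd (fun x' => energy (K x') y') k x) m y)
      - pd (fun x' => energy (K x') y) m x)

/-- The mixed curvature of the Berwald connection,
`Pˡ_ijk = - Gˡ_ijk = - ∂³Gˡ/∂yⁱ∂yʲ∂yᵏ`. -/
def mixedCurvature (K : Coord n → Coord n → ℝ) (l i j k : Fin n) (x y : Coord n) : ℝ :=
  - pd (pd (pd (spray K l x) i) j) k y

end Spray

/-! ### Finsler manifolds -/

section Manifold

variable {n : ℕ} {M : Type*} [TopologicalSpace M] [ChartedSpace (Coord n) M]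

/-- The restriction of `F` to the tangent space at `q` (which is `ℝⁿ` as a vector space). -/
def fiber [IsManifold (𝓡 n) ∞ M] (F : TangentBundle (𝓡 n) M → ℝ) (q : M) (v : Coord n) : ℝ :=
  F ⟨q, (v : TangentSpace (𝓡 n) q)⟩

/-- Finsler metrics on `M`. -/
structure IsFinslerMetric [IsManifold (𝓡 n) ∞ M] (F : TangentBundle (𝓡 n) M → ℝ) : Prop where
  continuous : Continuous F
  nonneg : ∀ v, 0 ≤ F v
  smooth : ContMDiffOn (𝓡 n).tangent 𝓘(ℝ, ℝ) ∞ F {v | v.2 ≠ 0}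
  homogeneous : ∀ (q : M) (v : TangentSpace (𝓡 n) q) (t : ℝ), 0 < t →
    F ⟨q, t • v⟩ = t * F ⟨q, v⟩
  strongly_convex : ∀ (q : M) (v : Coord n), v ≠ 0 → (gMatrix (fiber F q) v).PosDef

/-- The conformal change `e^α F`. -/
def conformal (α : M → ℝ) (F : TangentBundle (𝓡 n) M → ℝ) (v : TangentBundle (𝓡 n) M) : ℝ :=
  Real.exp (α v.proj) * F v

/-- The coordinate expression of `F` in the coordinates `(x, y)` of the tangent manifold induced by
the chart `φ`: the vector with coordinates `(x, y)` is `yⁱ ∂/∂uⁱ` at `φ⁻¹ x`. -/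
def inCoords (φ : OpenPartialHomeomorph M (Coord n)) (F : TangentBundle (𝓡 n) M → ℝ)
    (x y : Coord n) : ℝ :=
  F ⟨φ.symm x, mfderiv (𝓡 n) (𝓡 n) φ.symm x y⟩

/-- The partial derivatives `αₗ = ∂α/∂uˡ` at `q` in the chart `φ`. -/
def dCoords (φ : OpenPartialHomeomorph M (Coord n)) (α : M → ℝ) (q : M) (l : Fin n) : ℝ :=
  pd (fun x => α (φ.symm x)) l (φ q)

/-- The coordinates `(yⁱ)` in the chart `φ` of a tangent vector `v` at `q`. -/
def vecCoords (φ : OpenPartialHomeomorph M (Coord n)) (q : M) (v : TangentSpace (𝓡 n) q) :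
    Coord n :=
  mfderiv (𝓡 n) (𝓡 n) φ q v

end Manifold

end FinslerConformal

end

open FinslerConformal

/-! Fix the tangent space $V=T_pM$ and write $a=d_p\alpha$, $E=\frac12F^2$, and $X$ for the gradient
of $a$ with respect to the Hessian metric of $E$. The conformal change adds $y^l a(y)-E X^l$ to the
spray (`spray_conformal`). Contracting with $a$ and using (ii), the function $a^2-E\,a(X)$ has
vanishing third derivatives. It is 2-homogeneous, so $E\,a(X)=q$ for a quadratic form $q$
(`exists_quadratic_of_mixedCurvature_eq`), which is positive definite because $E$ and $a(X)$ are
positive.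

The core is that $E$ is invariant under every $q$-skew $B$ with $a\circ B=0$, i.e. $dE(By)=0$
(`apply_skew_eq_zero`). This is a maximum principle. Take a maximum of $(dE(By)+\varepsilon a^2)/E$
and differentiate twice in the direction $X$. Differentiating $E\,a(X)=q$ along $By$ evaluates the
third derivative of $E$ that appears, and what remains is $2E\,a(X)\le a(y)^2$. This reverses the
Cauchy–Schwarz inequality for $X$ and $y$, so $X$ is radial there and $dE(By)=0$ at the maximum.
Letting $\varepsilon\to0$ gives $dE(By)\le0$ everywhere, and $-B$ gives the other sign.

Hence $X$ is equivariant under these $B$ (`fderiv_gradient_skew`). They move a nonzero point of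
$\ker a$ in every $q$-orthogonal direction inside $\ker a$, so invariant functions of degree 0 are
constant on the connected set $\ker a\setminus\{0\}$. This applies to $a(X)$ and to $q(y,X)/F$; on
$\ker a$ the latter is a quarter of $F\,a(D_XX)$. -/

namespace FinslerConformal

/-! ### Homogeneous functions, Minkowski energies and gradients of linear forms. -/

section Minkowski

variable {V : Type*} [NormedAddCommGroup V] [NormedSpace ℝ V]

/-- `f` is smooth away from the origin. -/
def SmoothOff {W : Type*} [NormedAddCommGroup W] [NormedSpace ℝ W] (f : V → W) : Prop :=
  ∀ y, y ≠ 0 → ContDiffAt ℝ ∞ f y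

namespace SmoothOff

variable {W : Type*} [NormedAddCommGroup W] [NormedSpace ℝ W] {f g : V → W}

theorem fderiv (hf : SmoothOff f) : SmoothOff (fderiv ℝ f) := fun y hy =>
  (hf y hy).fderiv_right (m := ∞) (by simp)

theorem hasFDerivAt (hf : SmoothOff f) {y : V} (hy : y ≠ 0) :
    HasFDerivAt f (_root_.fderiv ℝ f y) y :=
  ((hf y hy).differentiableAt (by simp)).hasFDerivAt

theorem differentiableAt (hf : SmoothOff f) {y : V} (hy : y ≠ 0) : DifferentiableAt ℝ f y :=
  (hf y hy).differentiableAt (by simp)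

theorem congr (hf : SmoothOff f) (h : ∀ y, y ≠ 0 → g y = f y) : SmoothOff g := fun y hy =>
  (hf y hy).congr_of_eventuallyEq ((isOpen_ne.eventually_mem hy).mono fun z hz => h z hz)

theorem second_symm (hf : SmoothOff f) {y : V} (hy : y ≠ 0) (u v : V) :
    _root_.fderiv ℝ (_root_.fderiv ℝ f) y u v = _root_.fderiv ℝ (_root_.fderiv ℝ f) y v u :=
  ((hf y hy).isSymmSndFDerivAt (by simpa using ENat.LEInfty.out)) u v

/-- The derivative of a function homogeneous of degree `r + 1` is homogeneous of degree `r`. -/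
theorem fderiv_smul (hf : SmoothOff f) {s : ℝ} (hs : 0 < s) {r : ℕ}
    (h : ∀ v, v ≠ 0 → f (s • v) = s ^ (r + 1) • f v) {w : V} (hw : w ≠ 0) :
    _root_.fderiv ℝ f (s • w) = s ^ r • _root_.fderiv ℝ f w := by
  ext u
  have hsw : s • w ≠ 0 := smul_ne_zero hs.ne' hw
  have e1 : HasFDerivAt (fun v => f (s • v))
      ((_root_.fderiv ℝ f (s • w)).comp (s • ContinuousLinearMap.id ℝ V)) w :=
    (hf.hasFDerivAt hsw).comp w ((hasFDerivAt_id w).const_smul s)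
  have e2 : HasFDerivAt (fun v => f (s • v)) (s ^ (r + 1) • _root_.fderiv ℝ f w) w := by
    refine ((hf.hasFDerivAt hw).const_smul (s ^ (r + 1))).congr_of_eventuallyEq ?_
    filter_upwards [isOpen_ne.eventually_mem hw] with v hv
    simpa using h v hv
  have e3 := DFunLike.congr_fun (e1.unique e2) u
  simp only [ContinuousLinearMap.comp_apply, smul_apply, ContinuousLinearMap.id_apply,
    map_smul, pow_succ', mul_smul] at e3 ⊢
  exact smul_right_injective W hs.ne' e3

end SmoothOff

/-- Euler's relation for positively homogeneous functions. -/
theorem euler_relation {f : V → ℝ} {r : ℕ} {y : V} (hf : DifferentiableAt ℝ f y)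
    (h : ∀ t : ℝ, 0 < t → f (t • y) = t ^ r * f y) : fderiv ℝ f y y = r * f y := by
  have h1 : HasDerivAt (fun t : ℝ => f (t • y)) (fderiv ℝ f y y) 1 := by
    have h2 : HasDerivAt (fun t : ℝ => t • y) y 1 := by
      simpa using (hasDerivAt_id (1 : ℝ)).smul_const y
    have h3 : HasFDerivAt f (fderiv ℝ f y) ((1 : ℝ) • y) := by simpa using hf.hasFDerivAt
    exact h3.comp_hasDerivAt 1 h2
  have h4 : HasDerivAt (fun t : ℝ => t ^ r * f y) (r * f y) 1 := by
    simpa using (hasDerivAt_pow r (1 : ℝ)).mul_const (f y)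
  refine h1.unique (h4.congr_of_eventuallyEq ?_)
  filter_upwards [lt_mem_nhds (zero_lt_one (α := ℝ))] with t ht using h t ht

theorem euler_relation_fderiv {f : V → ℝ} (hf : SmoothOff f)
    (h : ∀ y, y ≠ 0 → ∀ t : ℝ, 0 < t → f (t • y) = t ^ 2 * f y) {y : V} (hy : y ≠ 0) (u : V) :
    fderiv ℝ (fderiv ℝ f) y y u = fderiv ℝ f y u := by
  have h1 : HasFDerivAt (fun z => fderiv ℝ f z z)
      (fderiv ℝ f y + (fderiv ℝ (fderiv ℝ f) y).flip y) y := by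
    refine ((hf.fderiv.hasFDerivAt hy).clm_apply (hasFDerivAt_id y)).congr_fderiv ?_
    ext; simp
  have h2 : HasFDerivAt (fun z => fderiv ℝ f z z) ((2 : ℝ) • fderiv ℝ f y) y := by
    refine ((hf.hasFDerivAt hy).const_smul (2 : ℝ)).congr_of_eventuallyEq ?_
    filter_upwards [isOpen_ne.eventually_mem hy] with z hz
    simpa using euler_relation (hf.differentiableAt hz) (h z hz)
  have h3 := DFunLike.congr_fun (h1.unique h2) u
  simp only [add_apply, ContinuousLinearMap.flip_apply,
    smul_apply, smul_eq_mul] at h3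
  rw [hf.second_symm hy]
  linarith

/-- Second derivatives are nonpositive at a local maximum. -/
theorem second_deriv_nonpos_of_isLocalMax {f f' : ℝ → ℝ} {c : ℝ}
    (hmax : IsLocalMax f 0) (hf : ∀ᶠ t in nhds 0, HasDerivAt f (f' t) t)
    (hf' : HasDerivAt f' c 0) : c ≤ 0 := by
  by_contra! hc
  have e1 : deriv f =ᶠ[nhds 0] f' := hf.mono fun t ht => ht.deriv
  have e2 : deriv (deriv f) 0 = c := by rw [e1.deriv_eq, hf'.deriv]
  -- A positive second derivative would make the maximum a minimum too, so `f` would be locally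
  -- constant.
  have hmin := isLocalMin_of_deriv_deriv_pos (f := f) (x₀ := 0) (by rw [e2]; exact hc)
    hmax.deriv_eq_zero hf.self_of_nhds.continuousAt
  have e3 : f =ᶠ[nhds 0] fun _ => f 0 := by
    filter_upwards [hmin, hmax] with t h1 h2 using le_antisymm h2 h1
  have e4 : deriv f =ᶠ[nhds 0] fun _ => (0 : ℝ) := e3.deriv.trans (by simp)
  rw [e4.deriv_eq] at e2
  simp at e2
  exact hc.ne e2

/-- The energies of smooth strongly convex positively homogeneous norms. -/
structure IsMinkowskiEnergy (E : V → ℝ) : Prop where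
  smooth : SmoothOff E
  homogeneous : ∀ y, y ≠ 0 → ∀ t : ℝ, 0 < t → E (t • y) = t ^ 2 * E y
  posDef : ∀ y, y ≠ 0 → ∀ v, v ≠ 0 → 0 < fderiv ℝ (fderiv ℝ E) y v v

/-- `X` is the gradient of the linear form `a` with respect to the Hessian metric of `E`. -/
structure IsGradient (E : V → ℝ) (a : V →L[ℝ] ℝ) (X : V → V) : Prop where
  smooth : SmoothOff X
  hess_apply : ∀ y, y ≠ 0 → fderiv ℝ (fderiv ℝ E) y (X y) = a

namespace IsMinkowskiEnergy

variable {E : V → ℝ}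

theorem hess_self (hE : IsMinkowskiEnergy E) {y : V} (hy : y ≠ 0) (u : V) :
    fderiv ℝ (fderiv ℝ E) y y u = fderiv ℝ E y u :=
  euler_relation_fderiv hE.smooth hE.homogeneous hy u

theorem fderiv_self (hE : IsMinkowskiEnergy E) {y : V} (hy : y ≠ 0) :
    fderiv ℝ E y y = 2 * E y := by
  simpa using euler_relation (hE.smooth.differentiableAt hy) (hE.homogeneous y hy)

theorem pos (hE : IsMinkowskiEnergy E) {y : V} (hy : y ≠ 0) : 0 < E y := by
  have h := hE.posDef y hy y hy
  rw [hE.hess_self hy, hE.fderiv_self hy] at h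
  linarith

theorem third_symm₂₃ (hE : IsMinkowskiEnergy E) {y : V} (hy : y ≠ 0) (u v w : V) :
    fderiv ℝ (fderiv ℝ (fderiv ℝ E)) y u v w = fderiv ℝ (fderiv ℝ (fderiv ℝ E)) y u w v := by
  have h1 := ((hE.smooth.fderiv.fderiv.hasFDerivAt hy).clm_apply
    (hasFDerivAt_const v y)).clm_apply (hasFDerivAt_const w y)
  have h2 := ((hE.smooth.fderiv.fderiv.hasFDerivAt hy).clm_apply
    (hasFDerivAt_const w y)).clm_apply (hasFDerivAt_const v y)
  have h3 : (fun z => fderiv ℝ (fderiv ℝ E) z v w) =ᶠ[nhds y]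
      fun z => fderiv ℝ (fderiv ℝ E) z w v := by
    filter_upwards [isOpen_ne.eventually_mem hy] with z hz using hE.smooth.second_symm hz v w
  simpa using DFunLike.congr_fun (h1.unique (h2.congr_of_eventuallyEq h3)) u

theorem third_symm₁₂ (hE : IsMinkowskiEnergy E) {y : V} (hy : y ≠ 0) (u v w : V) :
    fderiv ℝ (fderiv ℝ (fderiv ℝ E)) y u v w = fderiv ℝ (fderiv ℝ (fderiv ℝ E)) y v u w := by
  rw [hE.smooth.fderiv.second_symm hy u v]

variable {a : V →L[ℝ] ℝ} {X : V → V}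

/-- Differentiate the identity $g_y(X(y),w)=a(w)$, whose right side does not depend on $y$. -/
theorem hess_fderiv_gradient (hE : IsMinkowskiEnergy E) (hX : IsGradient E a X) {y : V}
    (hy : y ≠ 0) (u w : V) :
    fderiv ℝ (fderiv ℝ E) y (fderiv ℝ X y u) w
      = - fderiv ℝ (fderiv ℝ (fderiv ℝ E)) y u (X y) w := by
  have h1 := ((hE.smooth.fderiv.fderiv.hasFDerivAt hy).clm_apply
    (hX.smooth.hasFDerivAt hy)).clm_apply (hasFDerivAt_const w y)
  have h3 : (fun z => fderiv ℝ (fderiv ℝ E) z (X z) w) =ᶠ[nhds y] fun _ => a w := by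
    filter_upwards [isOpen_ne.eventually_mem hy] with z hz
    rw [hX.hess_apply z hz]
  have h4 := DFunLike.congr_fun
    (h1.unique ((hasFDerivAt_const (a w) y).congr_of_eventuallyEq h3)) u
  simp at h4
  linarith

theorem gradient_fderiv_apply (hE : IsMinkowskiEnergy E) (hX : IsGradient E a X) {y : V}
    (hy : y ≠ 0) (u : V) :
    a (fderiv ℝ X y u) = - fderiv ℝ (fderiv ℝ (fderiv ℝ E)) y u (X y) (X y) := by
  rw [← hE.hess_fderiv_gradient hX hy, ← hX.hess_apply y hy, hE.smooth.second_symm hy]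

theorem fderiv_gradient (hE : IsMinkowskiEnergy E) (hX : IsGradient E a X) {y : V}
    (hy : y ≠ 0) : fderiv ℝ E y (X y) = a y := by
  rw [← hE.hess_self hy, hE.smooth.second_symm hy, hX.hess_apply y hy]

theorem gradient_sq_pos (hE : IsMinkowskiEnergy E) (hX : IsGradient E a X) (ha : a ≠ 0) {y : V}
    (hy : y ≠ 0) : 0 < a (X y) := by
  have h0 : X y ≠ 0 := by
    intro h
    have := hX.hess_apply y hy
    rw [h, map_zero] at this
    exact ha this.symm
  have := hE.posDef y hy _ h0
  rwa [hX.hess_apply y hy] at this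

theorem hess_injective (hE : IsMinkowskiEnergy E) {y : V} (hy : y ≠ 0) {u v : V}
    (h : ∀ w, fderiv ℝ (fderiv ℝ E) y u w = fderiv ℝ (fderiv ℝ E) y v w) : u = v := by
  by_contra hne
  have := hE.posDef y hy (u - v) (sub_ne_zero.2 hne)
  rw [map_sub (fderiv ℝ (fderiv ℝ E) y), sub_apply, h, sub_self] at this
  exact this.false

/-- The Hessian of a 2-homogeneous function has degree 0, hence so has the gradient it defines. -/
theorem gradient_smul (hE : IsMinkowskiEnergy E) (hX : IsGradient E a X) {y : V} (hy : y ≠ 0)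
    {t : ℝ} (ht : 0 < t) : X (t • y) = X y := by
  have h1 : ∀ v, v ≠ 0 → fderiv ℝ E (t • v) = t ^ (0 + 1) • fderiv ℝ E v := fun v hv => by
    simpa using hE.smooth.fderiv_smul ht (r := 1)
      (fun v hv => by simpa using hE.homogeneous v hv t ht) hv
  have h2 := hE.smooth.fderiv.fderiv_smul ht h1 hy
  rw [pow_zero, one_smul] at h2
  refine hE.hess_injective hy fun w => ?_
  rw [← h2, hX.hess_apply _ (smul_ne_zero ht.ne' hy), h2, hX.hess_apply y hy]

/-! ### Invariance of the energy under infinitesimal isometries of the quadratic form. -/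

variable {q : V →L[ℝ] V →L[ℝ] ℝ}

/-- The derivative of the relation `E * a(X) = q`. -/
theorem fderiv_quadratic (hE : IsMinkowskiEnergy E) (hX : IsGradient E a X)
    (hqs : ∀ u v, q u v = q v u) (hq : ∀ y, y ≠ 0 → E y * a (X y) = q y y) {y : V}
    (hy : y ≠ 0) (u : V) :
    fderiv ℝ E y u * a (X y) + E y * a (fderiv ℝ X y u) = 2 * q y u := by
  have h1 := (hE.smooth.hasFDerivAt hy).mul (a.hasFDerivAt.comp y (hX.smooth.hasFDerivAt hy))
  have h2 : HasFDerivAt (fun z => q z z) (q y + q.flip y) y := by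
    refine ((q.hasFDerivAt (x := y)).clm_apply (hasFDerivAt_id y)).congr_fderiv ?_
    ext; simp
  have h3 : (fun z => E z * (a ∘ X) z) =ᶠ[nhds y] fun z => q z z := by
    filter_upwards [isOpen_ne.eventually_mem hy] with z hz using hq z hz
  have h4 := DFunLike.congr_fun (h1.unique (h2.congr_of_eventuallyEq h3)) u
  simp at h4
  rw [hqs u y] at h4
  linarith

/-- At a maximum of `(dE(By) + ε a²) / E` the gradient of `a` is radial. -/
theorem apply_skew_eq_zero_of_isMax (hE : IsMinkowskiEnergy E) (hX : IsGradient E a X)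
    (ha : a ≠ 0) (hqs : ∀ u v, q u v = q v u) (hq : ∀ y, y ≠ 0 → E y * a (X y) = q y y)
    {B : V →L[ℝ] V} (haB : ∀ v, a (B v) = 0) (hqB : ∀ v, q v (B v) = 0) {ε m : ℝ} (hε : 0 < ε)
    (hle : ∀ y, y ≠ 0 → fderiv ℝ E y (B y) + ε * a y ^ 2 ≤ m * E y) {y : V} (hy : y ≠ 0)
    (heq : fderiv ℝ E y (B y) + ε * a y ^ 2 = m * E y) : fderiv ℝ E y (B y) = 0 := by
  -- The function $dE(By)+\varepsilon a^2-mE$ is nonpositive and vanishes at `y`. It is restricted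
  -- to the line through `y` in the direction $X(y)$, because $D^3E(X,X,By)=-a(DX(By))$ is known
  -- from the quadratic relation.
  set x := X y with hx
  have hline : Filter.Tendsto (fun t : ℝ => y + t • x) (nhds 0) (nhds y) := by
    have : Continuous fun t : ℝ => y + t • x := by fun_prop
    simpa using this.tendsto 0
  have hne : ∀ᶠ t : ℝ in nhds 0, y + t • x ≠ 0 := hline.eventually (isOpen_ne.eventually_mem hy)
  have hld : ∀ t : ℝ, HasDerivAt (fun t : ℝ => y + t • x) x t := fun t => by
    simpa using ((hasDerivAt_id t).smul_const x).const_add y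
  have hdE : ∀ t : ℝ, y + t • x ≠ 0 → HasDerivAt (fun t : ℝ => fderiv ℝ E (y + t • x))
      (fderiv ℝ (fderiv ℝ E) (y + t • x) x) t := fun t ht =>
    (hE.smooth.fderiv.hasFDerivAt ht).comp_hasDerivAt t (hld t)
  have hB : ∀ t : ℝ, HasDerivAt (fun t : ℝ => B (y + t • x)) (B x) t := fun t =>
    B.hasFDerivAt.comp_hasDerivAt t (hld t)
  have haL : ∀ t : ℝ, HasDerivAt (fun t : ℝ => a (y + t • x)) (a x) t := fun t =>
    a.hasFDerivAt.comp_hasDerivAt t (hld t)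
  have key := second_deriv_nonpos_of_isLocalMax
    (f := fun t => fderiv ℝ E (y + t • x) (B (y + t • x)) + ε * a (y + t • x) ^ 2
      - m * E (y + t • x))
    (f' := fun t => fderiv ℝ (fderiv ℝ E) (y + t • x) x (B (y + t • x))
      + fderiv ℝ E (y + t • x) (B x) + ε * (2 * a (y + t • x) * a x)
      - m * fderiv ℝ E (y + t • x) x)
    (c := fderiv ℝ (fderiv ℝ (fderiv ℝ E)) y x x (B y) + fderiv ℝ (fderiv ℝ E) y x (B x)
      + fderiv ℝ (fderiv ℝ E) y x (B x) + ε * (2 * a x * a x)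
      - m * fderiv ℝ (fderiv ℝ E) y x x) ?_ ?_ ?_
  · have hH := hE.gradient_sq_pos hX ha hy
    have hEy := hE.pos hy
    have h1 := hE.gradient_fderiv_apply hX hy (B y)
    have h2 := hE.fderiv_quadratic hX hqs hq hy (B y)
    -- Now `h2` reads $dE(By)\,a(X)+E\,a(DX(By))=0$.
    rw [hqB, mul_zero] at h2
    rw [hE.third_symm₂₃ hy x x (B y), hE.third_symm₁₂ hy x (B y) x] at key
    rw [← hx] at h1 h2 hH
    rw [hX.hess_apply y hy, haB, ← neg_eq_iff_eq_neg.2 h1] at key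
    -- Multiplied by $E$, the second-order condition loses its $dE(By)$ terms. Only the
    -- $\varepsilon$ terms survive; without them it would be vacuous.
    have h3 : 2 * E y * a x ≤ a y ^ 2 := by
      have h4 : E y * (-a (fderiv ℝ X y (B y)) + 0 + 0 + ε * (2 * a x * a x) - m * a x) ≤ 0 :=
        mul_nonpos_of_nonneg_of_nonpos hEy.le key
      have h5 : (ε * a x) * (2 * E y * a x - a y ^ 2) ≤ 0 := by
        have e : (ε * a x) * (2 * E y * a x - a y ^ 2)
          = E y * (-a (fderiv ℝ X y (B y)) + 0 + 0 + ε * (2 * a x * a x) - m * a x) := by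
          linear_combination h2 - a x * heq
        rw [e]; exact h4
      have h6 : 0 < ε * a x := mul_pos hε hH
      nlinarith
    -- Equality case of Cauchy–Schwarz: the $g_y$-norm of `x` minus its projection to `y` is
    -- $a(x)-a(y)^2/(2E)\le0$.
    have hz : x = (a y / (2 * E y)) • y := by
      by_contra hne
      have hp := hE.posDef y hy _ (sub_ne_zero.2 hne)
      have e : fderiv ℝ (fderiv ℝ E) y (x - (a y / (2 * E y)) • y) (x - (a y / (2 * E y)) • y)
          = a x - a y ^ 2 / (2 * E y) := by
        have e1 : fderiv ℝ (fderiv ℝ E) y y = fderiv ℝ E y :=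
          ContinuousLinearMap.ext (hE.hess_self hy)
        simp only [map_sub, map_smul, sub_apply,
          smul_apply, smul_eq_mul, hx, hX.hess_apply y hy, e1,
          hE.fderiv_gradient hX hy, hE.fderiv_self hy]
        field_simp
        ring
      rw [e, sub_pos, div_lt_iff₀ (by positivity)] at hp
      linarith
    have h7 : a (B y) = (a y / (2 * E y)) * fderiv ℝ E y (B y) := by
      rw [← hE.hess_self hy, ← smul_eq_mul, ← smul_apply, ← map_smul, ← hz,
        hX.hess_apply y hy]
    rw [haB] at h7
    rcases mul_eq_zero.1 h7.symm with h8 | h8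
    · rw [h8, zero_smul] at hz
      rw [hz, map_zero] at hH
      exact absurd hH (lt_irrefl _)
    · exact h8
  · filter_upwards [hne] with t ht
    simpa [heq] using hle _ ht
  · filter_upwards [hne] with t ht
    have hE1 := (hE.smooth.hasFDerivAt ht).comp_hasDerivAt t (hld t)
    exact ((((hdE t ht).clm_apply (hB t)).add (((haL t).pow 2).const_mul ε)).sub
      (hE1.const_mul m)).congr_deriv (by simp)
  · have h0 : y + (0 : ℝ) • x ≠ 0 := by simpa using hy
    have hD2 : ∀ t : ℝ, y + t • x ≠ 0 → HasDerivAt (fun t : ℝ => fderiv ℝ (fderiv ℝ E) (y + t • x))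
        (fderiv ℝ (fderiv ℝ (fderiv ℝ E)) (y + t • x) x) t := fun t ht => by
      have h := hE.smooth.fderiv.fderiv.hasFDerivAt ht
      exact h.comp_hasDerivAt t (hld t)
    refine ((((((hD2 0 h0).clm_apply (hasDerivAt_const _ x)).clm_apply (hB 0)).add
      ((hdE 0 h0).clm_apply (hasDerivAt_const _ (B x)))).add
      ((((haL 0).const_mul 2).mul_const (a x)).const_mul ε)).sub
      (((hdE 0 h0).clm_apply (hasDerivAt_const _ x)).const_mul m)).congr_deriv ?_
    simp

/-- The quotients to be maximized have degree 0, so maxima over the unit sphere are maxima over all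
nonzero vectors. -/
theorem apply_skew_nonpos [FiniteDimensional ℝ V] (hE : IsMinkowskiEnergy E)
    (hX : IsGradient E a X)
    (ha : a ≠ 0) (hqs : ∀ u v, q u v = q v u) (hq : ∀ y, y ≠ 0 → E y * a (X y) = q y y)
    {B : V →L[ℝ] V} (haB : ∀ v, a (B v) = 0) (hqB : ∀ v, q v (B v) = 0) {y : V} (hy : y ≠ 0) :
    fderiv ℝ E y (B y) ≤ 0 := by
  have := FiniteDimensional.proper ℝ V
  have hne : (Metric.sphere (0 : V) 1).Nonempty :=
    ⟨‖y‖⁻¹ • y, by simp [norm_smul, hy]⟩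
  have hS : ∀ z ∈ Metric.sphere (0 : V) 1, z ≠ 0 := fun z hz h => by simp [h] at hz
  have hcE : ContinuousOn E (Metric.sphere (0 : V) 1) := fun z hz =>
    (hE.smooth z (hS z hz)).continuousAt.continuousWithinAt
  have hcdE : ContinuousOn (fderiv ℝ E) (Metric.sphere (0 : V) 1) := fun z hz =>
    (hE.smooth.fderiv z (hS z hz)).continuousAt.continuousWithinAt
  have hE0 : ∀ z ∈ Metric.sphere (0 : V) 1, E z ≠ 0 := fun z hz => (hE.pos (hS z hz)).ne'
  obtain ⟨z₁, hz₁, hM⟩ := (isCompact_sphere (0 : V) 1).exists_isMaxOn hne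
    (f := fun z => a z ^ 2 / E z) (ContinuousOn.div (by fun_prop) hcE hE0)
  set M := a z₁ ^ 2 / E z₁
  have main : ∀ ε : ℝ, 0 < ε → fderiv ℝ E y (B y) ≤ ε * M * E y := by
    intro ε hε
    obtain ⟨z, hz, hmax⟩ := (isCompact_sphere (0 : V) 1).exists_isMaxOn hne
      (f := fun z => (fderiv ℝ E z (B z) + ε * a z ^ 2) / E z)
      (ContinuousOn.div (by fun_prop) hcE hE0)
    set m := (fderiv ℝ E z (B z) + ε * a z ^ 2) / E z with hm
    have hle : ∀ w, w ≠ 0 → fderiv ℝ E w (B w) + ε * a w ^ 2 ≤ m * E w := by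
      intro w hw
      have hw' : 0 < ‖w‖ := norm_pos_iff.2 hw
      have hws : ‖w‖⁻¹ • w ∈ Metric.sphere (0 : V) 1 := by simp [norm_smul, hw]
      have h1 := hmax hws
      simp only [Set.mem_ofPred_eq] at h1
      rw [← hm, div_le_iff₀ (hE.pos (hS _ hws))] at h1
      set s := ‖w‖⁻¹ with hs
      have hs0 : 0 < s := inv_pos.2 hw'
      have hd : fderiv ℝ E (s • w) = s • fderiv ℝ E w := by
        simpa using hE.smooth.fderiv_smul hs0 (r := 1)
          (fun v hv => by simpa using hE.homogeneous v hv s hs0) hw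
      rw [hd, hE.homogeneous w hw s hs0] at h1
      simp only [map_smul, smul_apply, smul_eq_mul] at h1
      have h2 : s ^ 2 * (fderiv ℝ E w (B w) + ε * a w ^ 2) ≤ s ^ 2 * (m * E w) := by
        linarith
      exact le_of_mul_le_mul_left h2 (by positivity)
    have heq : fderiv ℝ E z (B z) + ε * a z ^ 2 = m * E z := by
      rw [hm, div_mul_cancel₀ _ (hE0 z hz)]
    have h0 := hE.apply_skew_eq_zero_of_isMax hX ha hqs hq haB hqB hε hle (hS z hz) heq
    -- At the maximum only the $\varepsilon$ term is left, which bounds `m` by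
    -- $\varepsilon\max(a^2/E)$.
    have hmM : m ≤ ε * M := by
      have h1 := hM hz
      simp only [Set.mem_ofPred_eq] at h1
      rw [hm, h0, zero_add, mul_div_assoc]
      exact mul_le_mul_of_nonneg_left h1 hε.le
    have h2 := hle y hy
    have h3 : m * E y ≤ ε * M * E y := mul_le_mul_of_nonneg_right hmM (hE.pos hy).le
    nlinarith [mul_nonneg hε.le (sq_nonneg (a y))]
  refine le_of_forall_pos_le_add fun δ hδ => ?_
  have hM0 : 0 ≤ M := div_nonneg (sq_nonneg _) (hE.pos (hS _ hz₁)).le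
  have hEy := hE.pos hy
  have hMy : 0 ≤ M * E y := mul_nonneg hM0 hEy.le
  -- The added 1 keeps the denominator positive when `M` is 0.
  have h := main (δ / (M * E y + 1)) (by positivity)
  have h' : δ / (M * E y + 1) * M * E y ≤ δ := by
    rw [div_mul_eq_mul_div, div_mul_eq_mul_div, div_le_iff₀ (by positivity)]
    nlinarith
  linarith

/-- The energy is invariant under the infinitesimal isometries of `q` that preserve `a`. -/
theorem apply_skew_eq_zero [FiniteDimensional ℝ V] (hE : IsMinkowskiEnergy E)
    (hX : IsGradient E a X)
    (ha : a ≠ 0) (hqs : ∀ u v, q u v = q v u) (hq : ∀ y, y ≠ 0 → E y * a (X y) = q y y)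
    {B : V →L[ℝ] V} (haB : ∀ v, a (B v) = 0) (hqB : ∀ v, q v (B v) = 0) {y : V} (hy : y ≠ 0) :
    fderiv ℝ E y (B y) = 0 := by
  refine le_antisymm (hE.apply_skew_nonpos hX ha hqs hq haB hqB hy) ?_
  have := hE.apply_skew_nonpos hX ha hqs hq (B := -B) (by simp [haB]) (by simp [hqB]) hy
  simpa using this

/-- The gradient of `a` is equivariant under the infinitesimal isometries of `q` that
preserve `a`. -/
theorem fderiv_gradient_skew [FiniteDimensional ℝ V] (hE : IsMinkowskiEnergy E)
    (hX : IsGradient E a X)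
    (ha : a ≠ 0) (hqs : ∀ u v, q u v = q v u) (hq : ∀ y, y ≠ 0 → E y * a (X y) = q y y)
    {B : V →L[ℝ] V} (haB : ∀ v, a (B v) = 0) (hqB : ∀ v, q v (B v) = 0) {y : V} (hy : y ≠ 0) :
    fderiv ℝ X y (B y) = B (X y) := by
  -- The invariance $dE(Bz)=0$ is differentiated once in the direction `u`, and below a second time
  -- in the direction $X(y)$, where $a\circ B=0$ removes a term.
  have h1 : ∀ z, z ≠ 0 → ∀ u,
      fderiv ℝ (fderiv ℝ E) z u (B z) + fderiv ℝ E z (B u) = 0 := by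
    intro z hz u
    have e1 := (hE.smooth.fderiv.hasFDerivAt hz).clm_apply (B.hasFDerivAt (x := z))
    have e2 : (fun z => fderiv ℝ E z (B z)) =ᶠ[nhds z] fun _ => 0 := by
      filter_upwards [isOpen_ne.eventually_mem hz] with w hw using
        hE.apply_skew_eq_zero hX ha hqs hq haB hqB hw
    have e3 := DFunLike.congr_fun
      (e1.unique ((hasFDerivAt_const (0 : ℝ) z).congr_of_eventuallyEq e2)) u
    simp at e3
    linarith
  refine hE.hess_injective hy fun w => ?_
  have e1 := (((hE.smooth.fderiv.fderiv.hasFDerivAt hy).clm_apply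
    (hasFDerivAt_const w y)).clm_apply (B.hasFDerivAt (x := y))).add
    ((hE.smooth.fderiv.hasFDerivAt hy).clm_apply (hasFDerivAt_const (B w) y))
  have e2 : (fun z => fderiv ℝ (fderiv ℝ E) z w (B z) + fderiv ℝ E z (B w))
      =ᶠ[nhds y] fun _ => 0 := by
    filter_upwards [isOpen_ne.eventually_mem hy] with z hz using h1 z hz w
  have e3 := DFunLike.congr_fun
    (e1.unique ((hasFDerivAt_const (0 : ℝ) y).congr_of_eventuallyEq e2)) (X y)
  simp [hX.hess_apply y hy, haB] at e3
  rw [hE.hess_fderiv_gradient hX hy, hE.smooth.second_symm hy (B (X y)), hE.third_symm₁₂ hy,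
    hE.third_symm₂₃ hy]
  linarith

end IsMinkowskiEnergy

end Minkowski

/-! ### Constancy on the hyperplane, and recognition of quadratic forms. -/

section Kernel

variable {V : Type*} [NormedAddCommGroup V] [NormedSpace ℝ V]

/-- A function on `ker a \ {0}` whose derivatives vanish in the radial and the `q`-orthogonal
directions is constant. -/
theorem constant_on_ker_of_fderiv [FiniteDimensional ℝ V] (hn : 3 ≤ Module.finrank ℝ V)
    {a : V →L[ℝ] ℝ} {q : V →L[ℝ] V →L[ℝ] ℝ}
    (hqpos : ∀ y, y ≠ 0 → 0 < q y y) {h : V → ℝ} (hs : SmoothOff h)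
    (hrad : ∀ y, y ≠ 0 → fderiv ℝ h y y = 0)
    (hort : ∀ y, y ≠ 0 → a y = 0 → ∀ v, a v = 0 → q y v = 0 → fderiv ℝ h y v = 0) :
    ∃ c : ℝ, ∀ y, y ≠ 0 → a y = 0 → h y = c := by
  let W : Submodule ℝ V := LinearMap.ker (a : V →ₗ[ℝ] ℝ)
  have hW : 1 < Module.finrank ℝ W := by
    have h1 := LinearMap.finrank_range_add_finrank_ker (a : V →ₗ[ℝ] ℝ)
    have h2 : Module.finrank ℝ (LinearMap.range (a : V →ₗ[ℝ] ℝ)) ≤ 1 := by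
      simpa using Submodule.finrank_le (LinearMap.range (a : V →ₗ[ℝ] ℝ))
    change _ + Module.finrank ℝ W = _ at h1
    omega
  have hconn : IsPreconnected ({0}ᶜ : Set W) :=
    (isConnected_compl_singleton_of_one_lt_rank
      (by rw [← Module.finrank_eq_rank]; exact_mod_cast hW) 0).isPreconnected
  have hder : ∀ w : W, w ≠ 0 → HasFDerivAt (fun w : W => h w) (0 : W →L[ℝ] ℝ) w := by
    intro w hw
    have hw' : (w : V) ≠ 0 := by simpa using hw
    refine ((hs.hasFDerivAt hw').comp w W.subtypeL.hasFDerivAt).congr_fderiv ?_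
    ext v
    have hwa : a w = 0 := w.2
    have hva : a v = 0 := v.2
    have hp := (hqpos _ hw').ne'
    -- The tangent vector minus its $q$-projection to `w`; the radial part contributes nothing.
    have h0 := hort w hw' hwa (v - (q w v / q w w) • (w : V)) (by simp [hwa, hva])
      (by simp [hp])
    rw [map_sub, map_smul, hrad _ hw', smul_zero, sub_zero] at h0
    simpa using h0
  obtain ⟨c, hc⟩ := isOpen_compl_singleton.exists_is_const_of_fderiv_eq_zero (𝕜 := ℝ) hconn
    (f := fun w : W => h w)
    (fun w hw => (hder w hw).differentiableAt.differentiableWithinAt)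
    (fun w hw => (hder w hw).fderiv)
  exact ⟨c, fun y hy hay => hc ⟨y, hay⟩ (by simpa [Subtype.ext_iff] using hy)⟩

namespace IsMinkowskiEnergy

variable {E : V → ℝ} {a : V →L[ℝ] ℝ} {X : V → V}

/-- This is the infinitesimal form of the degree-0 homogeneity of `X`, obtained by differentiating
Euler's relation for $dE$. -/
theorem fderiv_gradient_self (hE : IsMinkowskiEnergy E) (hX : IsGradient E a X) {y : V}
    (hy : y ≠ 0) : fderiv ℝ X y y = 0 := by
  refine hE.hess_injective hy fun w => ?_
  rw [hE.hess_fderiv_gradient hX hy, hE.third_symm₁₂ hy]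
  have e1 := ((hE.smooth.fderiv.fderiv.hasFDerivAt hy).clm_apply
    (hasFDerivAt_id y)).clm_apply (hasFDerivAt_const w y)
  have e2 : (fun z => fderiv ℝ (fderiv ℝ E) z (id z) w) =ᶠ[nhds y] fun z => fderiv ℝ E z w := by
    filter_upwards [isOpen_ne.eventually_mem hy] with z hz using hE.hess_self hz w
  have e3 := DFunLike.congr_fun (e1.unique (((hE.smooth.fderiv.hasFDerivAt hy).clm_apply
    (hasFDerivAt_const w y)).congr_of_eventuallyEq e2)) (X y)
  simp at e3
  simp [e3]

variable {q : V →L[ℝ] V →L[ℝ] ℝ}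

/-- The infinitesimal rotation of the plane of `y`, `v` with respect to `q`. -/
theorem exists_skew (hqs : ∀ u v, q u v = q v u) (hqpos : ∀ y, y ≠ 0 → 0 < q y y)
    {y v : V} (hy : y ≠ 0) (hay : a y = 0) (hav : a v = 0) (hyv : q y v = 0) :
    ∃ B : V →L[ℝ] V, (∀ u, a (B u) = 0) ∧ (∀ u, q u (B u) = 0) ∧ B y = v := by
  refine ⟨(q y y)⁻¹ • ((q y).smulRight v - (q v).smulRight y), fun u => ?_, fun u => ?_, ?_⟩
  · simp [hay, hav]
  · simp only [smul_apply, sub_apply, ContinuousLinearMap.smulRight_apply, map_smul, map_sub,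
      smul_eq_mul, hqs u v, hqs u y]
    ring
  · simp [hqs v y, hyv, (hqpos y hy).ne']

/-- If `E * a(X)` is a quadratic form, then `a(X)` and `√(2E) * a(D_X X)` are constant on the
kernel of `a`. -/
theorem constant_on_ker [FiniteDimensional ℝ V] (hn : 3 ≤ Module.finrank ℝ V)
    (hE : IsMinkowskiEnergy E) (hX : IsGradient E a X) (ha : a ≠ 0)
    (hqs : ∀ u v, q u v = q v u) (hq : ∀ y, y ≠ 0 → E y * a (X y) = q y y) :
    (∃ c : ℝ, ∀ y, y ≠ 0 → a y = 0 → a (X y) = c) ∧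
    (∃ c : ℝ, ∀ y, y ≠ 0 → a y = 0 → √(2 * E y) * a (fderiv ℝ X y (X y)) = c) := by
  have hqpos : ∀ y, y ≠ 0 → 0 < q y y := fun y hy => by
    rw [← hq y hy]; exact mul_pos (hE.pos hy) (hE.gradient_sq_pos hX ha hy)
  constructor
  · refine constant_on_ker_of_fderiv hn hqpos (h := fun y => a (X y))
      (fun y hy => a.contDiff.contDiffAt.comp y (hX.smooth y hy)) ?_ ?_
    · intro y hy
      have h := (a.hasFDerivAt.comp y (hX.smooth.hasFDerivAt hy)).fderiv
      change fderiv ℝ (a ∘ X) y y = 0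
      rw [h]
      simp [hE.fderiv_gradient_self hX hy]
    · intro y hy hay v hav hyv
      obtain ⟨B, haB, hqB, rfl⟩ := exists_skew (a := a) hqs hqpos hy hay hav hyv
      have h := (a.hasFDerivAt.comp y (hX.smooth.hasFDerivAt hy)).fderiv
      change fderiv ℝ (a ∘ X) y (B y) = 0
      rw [h]
      simp [hE.fderiv_gradient_skew hX ha hqs hq haB hqB hy, haB]
  -- The derivative of $q(y,X)/\sqrt{2E}$, a degree-0 function built only from invariant data.
  · have hJ : ∀ y, y ≠ 0 → HasFDerivAt (fun z => q z (X z) * (√(2 * E z))⁻¹) _ y := fun y hy =>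
      ((q.hasFDerivAt (x := y)).clm_apply (hX.smooth.hasFDerivAt hy)).mul
        ((hasDerivAt_inv (by have := hE.pos hy; positivity)).comp_hasFDerivAt y
          (((hE.smooth.hasFDerivAt hy).const_mul 2).sqrt
            (by have := hE.pos hy; positivity)))
    have hsq : ∀ y, y ≠ 0 → 0 < √(2 * E y) ∧ √(2 * E y) ^ 2 = 2 * E y := fun y hy => by
      have := hE.pos hy
      exact ⟨by positivity, Real.sq_sqrt (by positivity)⟩
    have hJs : SmoothOff fun z => q z (X z) * (√(2 * E z))⁻¹ := by
      intro y hy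
      have := hE.pos hy
      exact ((q.contDiff.contDiffAt).clm_apply (hX.smooth y hy)).mul
        (((contDiffAt_const.mul (hE.smooth y hy)).sqrt (by positivity)).inv (by positivity))
    obtain ⟨c, hc⟩ : ∃ c : ℝ, ∀ y, y ≠ 0 → a y = 0 → q y (X y) * (√(2 * E y))⁻¹ = c := by
      refine constant_on_ker_of_fderiv hn (a := a) hqpos hJs ?_ ?_
      · intro y hy
        obtain ⟨h2, h3⟩ := hsq y hy
        have := hE.pos hy
        rw [(hJ y hy).fderiv]
        simp only [add_apply, smul_apply, ContinuousLinearMap.comp_apply,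
          ContinuousLinearMap.flip_apply, hE.fderiv_gradient_self hX hy, hE.fderiv_self hy,
          map_zero, zero_add, smul_eq_mul]
        generalize √(2 * E y) = s at h2 h3 ⊢
        rw [← h3]
        field_simp
        ring
      · intro y hy hay v hav hyv
        obtain ⟨B, haB, hqB, rfl⟩ := exists_skew (a := a) hqs hqpos hy hay hav hyv
        -- Polarization of $q(v,Bv)=0$ at $v=y+X(y)$.
        have h4 : q (B y) (X y) + q y (B (X y)) = 0 := by
          have h := hqB (y + X y)
          simp only [map_add, add_apply, hqB] at h
          rw [hqs (B y)]
          linarith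
        rw [(hJ y hy).fderiv]
        simp only [add_apply, smul_apply, ContinuousLinearMap.comp_apply,
          ContinuousLinearMap.flip_apply, hE.fderiv_gradient_skew hX ha hqs hq haB hqB hy,
          hE.apply_skew_eq_zero hX ha hqs hq haB hqB hy, smul_eq_mul]
        linear_combination (√(2 * E y))⁻¹ * h4
    -- On $\ker a$ one has $dE(X)=a(y)=0$, so $E\,a(D_XX)=2q(y,X)$. With $E=\frac12F^2$ this is
    -- $F\,a(D_XX)=4q(y,X)/F$.
    refine ⟨4 * c, fun y hy hay => ?_⟩
    rw [← hc y hy hay]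
    have h1 := hE.fderiv_quadratic hX hqs hq hy (X y)
    rw [hE.fderiv_gradient hX hy, hay, zero_mul, zero_add] at h1
    obtain ⟨h2, h3⟩ := hsq y hy
    field_simp
    rw [h3]
    linarith

end IsMinkowskiEnergy

/-- A positively 2-homogeneous function with vanishing third derivatives is a quadratic form. -/
theorem exists_quadratic_of_third_fderiv_eq_zero [FiniteDimensional ℝ V]
    (hn : 1 < Module.finrank ℝ V) {f : V → ℝ} (hf : SmoothOff f)
    (hhom : ∀ y, y ≠ 0 → ∀ t : ℝ, 0 < t → f (t • y) = t ^ 2 * f y)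
    (h3 : ∀ y, y ≠ 0 → fderiv ℝ (fderiv ℝ (fderiv ℝ f)) y = 0) :
    ∃ q : V →L[ℝ] V →L[ℝ] ℝ, (∀ u v, q u v = q v u) ∧ ∀ y, y ≠ 0 → f y = q y y := by
  have hconn : IsPreconnected ({0}ᶜ : Set V) :=
    (isConnected_compl_singleton_of_one_lt_rank
      (by rw [← Module.finrank_eq_rank]; exact_mod_cast hn) 0).isPreconnected
  obtain ⟨b, hb⟩ := isOpen_compl_singleton.exists_is_const_of_fderiv_eq_zero (𝕜 := ℝ) hconn
    (f := fderiv ℝ (fderiv ℝ f))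
    (fun w hw => (hf.fderiv.fderiv.differentiableAt hw).differentiableWithinAt)
    (fun w hw => h3 w hw)
  have : Nontrivial V := Module.nontrivial_of_finrank_pos (R := ℝ) (by omega)
  obtain ⟨z, hz⟩ := exists_ne (0 : V)
  -- The Hessian is a constant `b`, as $V\setminus\{0\}$ is connected; Euler's relations give
  -- $b(y,y)=2f(y)$.
  refine ⟨(1 / 2 : ℝ) • b, fun u v => ?_, fun y hy => ?_⟩
  · have := hf.second_symm hz u v
    rw [hb z hz] at this
    simp [this]
  · have h1 := euler_relation_fderiv hf hhom hy y
    have h2 := euler_relation (r := 2) (hf.differentiableAt hy) (hhom y hy)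
    rw [hb y hy, h2] at h1
    simp [h1]

end Kernel

/-! ### Translation between partial derivatives, matrices and Fréchet derivatives. -/

section Coordinates

variable {n : ℕ}

theorem coord_eq_sum (u : Coord n) : u = ∑ i, u i • EuclideanSpace.single i (1 : ℝ) := by
  ext j
  simp [Pi.single_apply]

theorem map_coord_eq_sum {W : Type*} [NormedAddCommGroup W] [NormedSpace ℝ W]
    (f : Coord n →L[ℝ] W) (u : Coord n) :
    f u = ∑ i, u i • f (EuclideanSpace.single i 1) := by
  conv_lhs => rw [coord_eq_sum u]
  simp

namespace SmoothOff

variable {f g : Coord n → ℝ}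

theorem pd (hf : SmoothOff f) (i : Fin n) : SmoothOff (FinslerConformal.pd f i) := fun y hy =>
  (hf.fderiv y hy).clm_apply contDiffAt_const

theorem mul (hf : SmoothOff f) (hg : SmoothOff g) : SmoothOff fun y => f y * g y :=
  fun y hy => (hf y hy).mul (hg y hy)

theorem sub (hf : SmoothOff f) (hg : SmoothOff g) : SmoothOff fun y => f y - g y :=
  fun y hy => (hf y hy).sub (hg y hy)

theorem const (c : ℝ) : SmoothOff fun _ : Coord n => c := fun _ _ => contDiffAt_const

theorem coord (i : Fin n) : SmoothOff fun y : Coord n => y i := fun _ _ => by fun_prop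

theorem sum {ι : Type*} (s : Finset ι) {F : ι → Coord n → ℝ} (hF : ∀ i ∈ s, SmoothOff (F i)) :
    SmoothOff fun y => ∑ i ∈ s, F i y :=
  fun y hy => ContDiffAt.sum fun i hi => hF i hi y hy

theorem pd_pd_apply (hf : SmoothOff f) (i j : Fin n) {y : Coord n} (hy : y ≠ 0) :
    FinslerConformal.pd (FinslerConformal.pd f i) j y
      = _root_.fderiv ℝ (_root_.fderiv ℝ f) y (EuclideanSpace.single j 1)
          (EuclideanSpace.single i 1) := by
  have h := ((hf.fderiv.hasFDerivAt hy).clm_apply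
    (hasFDerivAt_const (EuclideanSpace.single i (1 : ℝ)) y)).fderiv
  unfold FinslerConformal.pd
  rw [h]
  simp

theorem pd_pd_pd_apply (hf : SmoothOff f) (i j k : Fin n) {y : Coord n} (hy : y ≠ 0) :
    FinslerConformal.pd (FinslerConformal.pd (FinslerConformal.pd f i) j) k y
      = _root_.fderiv ℝ (_root_.fderiv ℝ (_root_.fderiv ℝ f)) y (EuclideanSpace.single k 1)
          (EuclideanSpace.single j 1) (EuclideanSpace.single i 1) := by
  have h := (((hf.fderiv.fderiv.hasFDerivAt hy).clm_apply
    (hasFDerivAt_const (EuclideanSpace.single j (1 : ℝ)) y)).clm_apply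
    (hasFDerivAt_const (EuclideanSpace.single i (1 : ℝ)) y)).fderiv
  have e : FinslerConformal.pd (FinslerConformal.pd f i) j =ᶠ[nhds y] fun z =>
      _root_.fderiv ℝ (_root_.fderiv ℝ f) z (EuclideanSpace.single j 1)
          (EuclideanSpace.single i 1) := by
    filter_upwards [isOpen_ne.eventually_mem hy] with z hz using hf.pd_pd_apply i j hz
  change _root_.fderiv ℝ (FinslerConformal.pd (FinslerConformal.pd f i) j) y _ = _
  rw [e.fderiv_eq, h]
  simp

end SmoothOff

theorem pd_congr {f g : Coord n → ℝ} (h : ∀ y, y ≠ 0 → f y = g y) (i : Fin n) :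
    ∀ y, y ≠ 0 → pd f i y = pd g i y := by
  intro y hy
  have e : f =ᶠ[nhds y] g := by
    filter_upwards [isOpen_ne.eventually_mem hy] with z hz using h z hz
  unfold pd
  rw [e.fderiv_eq]

theorem pd_add {f g : Coord n → ℝ} (hf : SmoothOff f) (hg : SmoothOff g) (i : Fin n) :
    ∀ y, y ≠ 0 → pd (fun y => f y + g y) i y = pd f i y + pd g i y := by
  intro y hy
  unfold pd
  rw [fderiv_fun_add (hf.differentiableAt hy) (hg.differentiableAt hy)]
  simp

theorem pd_sum_mul {ι : Type*} [Fintype ι] {F : ι → Coord n → ℝ} (hF : ∀ l, SmoothOff (F l))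
    (a : ι → ℝ) (i : Fin n) :
    ∀ y, y ≠ 0 → pd (fun y => ∑ l, F l y * a l) i y = ∑ l, pd (F l) i y * a l := by
  intro y hy
  unfold pd
  rw [(HasFDerivAt.fun_sum fun l _ => ((hF l).hasFDerivAt hy).mul_const (a l)).fderiv]
  simp [mul_comm]

/-- The linear form with the components `a`. -/
noncomputable def linForm (a : Fin n → ℝ) : Coord n →L[ℝ] ℝ :=
  ∑ l, a l • EuclideanSpace.proj l

theorem linForm_apply (a : Fin n → ℝ) (y : Coord n) : linForm a y = ∑ l, a l * y l := by
  simp [linForm]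

theorem smoothOff_det {ι : Type*} [Fintype ι] [DecidableEq ι] {A : Coord n → Matrix ι ι ℝ}
    (hA : ∀ i j, SmoothOff fun y => A y i j) : SmoothOff fun y => (A y).det := by
  intro y hy
  simp only [Matrix.det_apply]
  exact ContDiffAt.sum fun σ _ => (contDiffAt_prod fun i _ => hA _ _ y hy).const_smul _

/-- Cramer's rule: the entries are cofactors divided by the determinant. -/
theorem smoothOff_inv {ι : Type*} [Fintype ι] [DecidableEq ι] {A : Coord n → Matrix ι ι ℝ}
    (hA : ∀ i j, SmoothOff fun y => A y i j) (hdet : ∀ y, y ≠ 0 → (A y).det ≠ 0) (i j : ι) :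
    SmoothOff fun y => (A y)⁻¹ i j := by
  have hadj : SmoothOff fun y => (A y).adjugate i j := by
    simp only [Matrix.adjugate_apply]
    refine smoothOff_det fun k l => ?_
    simp only [Matrix.updateRow_apply]
    split_ifs
    · exact fun _ _ => contDiffAt_const
    · exact hA k l
  intro y hy
  simp only [Matrix.inv_def, Ring.inverse_eq_inv', Matrix.smul_apply, smul_eq_mul]
  exact ((smoothOff_det hA y hy).inv (hdet y hy)).mul (hadj y hy)

section Minkowski

variable {L : Coord n → ℝ}

theorem gMatrix_apply (hL : SmoothOff (energy L)) {y : Coord n} (hy : y ≠ 0) (i j : Fin n) :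
    gMatrix L y i j = fderiv ℝ (fderiv ℝ (energy L)) y (EuclideanSpace.single j 1)
      (EuclideanSpace.single i 1) :=
  hL.pd_pd_apply i j hy

theorem smoothOff_gMatrix (hL : SmoothOff (energy L)) (i j : Fin n) :
    SmoothOff fun y => gMatrix L y i j :=
  (hL.pd i).pd j

theorem hess_eq_sum (hL : SmoothOff (energy L)) {y : Coord n} (hy : y ≠ 0) (u v : Coord n) :
    fderiv ℝ (fderiv ℝ (energy L)) y u v = ∑ i, v i * ∑ j, gMatrix L y i j * u j := by
  rw [map_coord_eq_sum (fderiv ℝ (fderiv ℝ (energy L)) y u) v]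
  refine Finset.sum_congr rfl fun i _ => ?_
  rw [map_coord_eq_sum (fderiv ℝ (fderiv ℝ (energy L)) y) u]
  simp [gMatrix_apply hL hy, mul_comm]

theorem gMatrix_symm (hL : SmoothOff (energy L)) {y : Coord n} (hy : y ≠ 0) (i j : Fin n) :
    gMatrix L y i j = gMatrix L y j i := by
  rw [gMatrix_apply hL hy, gMatrix_apply hL hy, hL.second_symm hy]

theorem gMatrix_posDef_iff (hL : SmoothOff (energy L)) {y : Coord n} (hy : y ≠ 0) :
    (gMatrix L y).PosDef ↔ ∀ v, v ≠ 0 → 0 < fderiv ℝ (fderiv ℝ (energy L)) y v v := by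
  constructor
  · intro h v hv
    have := h.dotProduct_mulVec_pos (x := v.ofLp) (by simpa using hv)
    rw [hess_eq_sum hL hy]
    simpa [dotProduct, Matrix.mulVec] using this
  · intro h
    refine Matrix.PosDef.of_dotProduct_mulVec_pos ?_ fun v hv => ?_
    · ext i j
      simpa using gMatrix_symm hL hy j i
    · have := h (WithLp.toLp 2 v) (by simpa using hv)
      rw [hess_eq_sum hL hy] at this
      simpa [dotProduct, Matrix.mulVec] using this

theorem det_gMatrix_ne_zero (hE : IsMinkowskiEnergy (energy L)) {y : Coord n} (hy : y ≠ 0) :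
    (gMatrix L y).det ≠ 0 :=
  ((gMatrix_posDef_iff hE.smooth hy).2 (hE.posDef y hy)).det_pos.ne'

/-- The vector with the components `gradX`. -/
noncomputable def gradVec (L : Coord n → ℝ) (a : Fin n → ℝ) (y : Coord n) : Coord n :=
  WithLp.toLp 2 fun l => gradX L a l y

theorem smoothOff_gradX (hE : IsMinkowskiEnergy (energy L)) (a : Fin n → ℝ) (l : Fin n) :
    SmoothOff (gradX L a l) :=
  SmoothOff.sum _ fun k _ => (smoothOff_inv (smoothOff_gMatrix hE.smooth)
    (fun _ hy => det_gMatrix_ne_zero hE hy) l k).mul (SmoothOff.const _)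

theorem isGradient_gradVec (hE : IsMinkowskiEnergy (energy L)) (a : Fin n → ℝ) :
    IsGradient (energy L) (linForm a) (gradVec L a) where
  smooth y hy := contDiffAt_euclidean.2 fun l => smoothOff_gradX hE a l y hy
  hess_apply y hy := by
    ext v
    rw [hess_eq_sum hE.smooth hy, linForm_apply]
    refine Finset.sum_congr rfl fun i _ => ?_
    rw [mul_comm]
    congr 1
    have h : (gMatrix L y).mulVec ((gMatrix L y)⁻¹.mulVec a) = a := by
      rw [Matrix.mulVec_mulVec, Matrix.mul_nonsing_inv _
        (isUnit_iff_ne_zero.2 (det_gMatrix_ne_zero hE hy)), Matrix.one_mulVec]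
    exact congrFun h i

theorem gradSq_eq (L : Coord n → ℝ) (a : Fin n → ℝ) (y : Coord n) :
    gradSq L a y = linForm a (gradVec L a y) := by
  rw [linForm_apply]
  exact Finset.sum_congr rfl fun l _ => mul_comm _ _

theorem gradDeriv_eq (hE : IsMinkowskiEnergy (energy L)) (a : Fin n → ℝ) {y : Coord n}
    (hy : y ≠ 0) :
    gradDeriv L a y = linForm a (fderiv ℝ (gradVec L a) y (gradVec L a y)) := by
  rw [linForm_apply]
  refine Finset.sum_congr rfl fun l _ => ?_
  have h1 : HasFDerivAt (gradX L a l) ((EuclideanSpace.proj l : Coord n →L[ℝ] ℝ).comp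
      (fderiv ℝ (gradVec L a) y)) y :=
    (EuclideanSpace.proj l : Coord n →L[ℝ] ℝ).hasFDerivAt.comp y
      ((isGradient_gradVec hE a).smooth.hasFDerivAt hy)
  have h2 := map_coord_eq_sum (fderiv ℝ (gradX L a l) y) (gradVec L a y)
  have h3 : (fderiv ℝ (gradVec L a) y (gradVec L a y)) l
      = ∑ s, gradVec L a y s * pd (gradX L a l) s y := by
    rw [h1.fderiv] at h2
    unfold pd
    rw [h1.fderiv]
    exact h2
  rw [h3, Finset.mul_sum]
  refine Finset.sum_congr rfl fun s _ => ?_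
  change _ = a l * (gradX L a s y * _)
  ring

/-- `gˡᵐ ∂E/∂yᵐ = yˡ`. -/
theorem sum_inv_mul_pd_energy (hE : IsMinkowskiEnergy (energy L)) {y : Coord n} (hy : y ≠ 0)
    (l : Fin n) : ∑ m, (gMatrix L y)⁻¹ l m * pd (energy L) m y = y l := by
  have h1 : (gMatrix L y).mulVec y.ofLp = fun m => pd (energy L) m y := by
    ext m
    have h := hE.hess_self hy (EuclideanSpace.single m 1)
    rw [hess_eq_sum hE.smooth hy] at h
    simpa [Matrix.mulVec, dotProduct, pd, Pi.single_apply] using h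
  have h2 : (gMatrix L y)⁻¹.mulVec ((gMatrix L y).mulVec y.ofLp) = y.ofLp := by
    rw [Matrix.mulVec_mulVec, Matrix.nonsing_inv_mul _
      (isUnit_iff_ne_zero.2 (det_gMatrix_ne_zero hE hy)), Matrix.one_mulVec]
  rw [h1] at h2
  exact congrFun h2 l

end Minkowski

end Coordinates

/-! ### Conformal change of the spray and of the mixed curvature. -/

section Conformal

variable {n : ℕ}

theorem pd_eq_fderiv_prod {f : Coord n × Coord n → ℝ} {x y : Coord n}
    (hf : DifferentiableAt ℝ f (x, y)) (k : Fin n) :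
    pd (fun x' => f (x', y)) k x = fderiv ℝ f (x, y) (EuclideanSpace.single k 1, 0) := by
  have h : HasFDerivAt (fun x' => f (x', y))
      ((fderiv ℝ f (x, y)).comp (ContinuousLinearMap.inl ℝ (Coord n) (Coord n))) x :=
    hf.hasFDerivAt.comp x (hasFDerivAt_prodMk_left x y)
  unfold pd
  rw [h.fderiv]
  simp

variable {K : Coord n → Coord n → ℝ} {x₀ : Coord n}

theorem contDiffAt_energy_prod
    (hK : ∀ y, y ≠ 0 → ContDiffAt ℝ ∞ (fun z : Coord n × Coord n => K z.1 z.2) (x₀, y))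
    {y : Coord n} (hy : y ≠ 0) :
    ContDiffAt ℝ ∞ (fun z : Coord n × Coord n => energy (K z.1) z.2) (x₀, y) :=
  contDiffAt_const.mul ((hK y hy).pow 2)

theorem smoothOff_energy
    (hK : ∀ y, y ≠ 0 → ContDiffAt ℝ ∞ (fun z : Coord n × Coord n => K z.1 z.2) (x₀, y)) :
    SmoothOff (energy (K x₀)) := fun y hy =>
  (contDiffAt_energy_prod hK hy).comp (f := fun y => (x₀, y)) y
    (contDiffAt_const.prodMk contDiffAt_id)

theorem smoothOff_pd_energy
    (hK : ∀ y, y ≠ 0 → ContDiffAt ℝ ∞ (fun z : Coord n × Coord n => K z.1 z.2) (x₀, y))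
    (k : Fin n) : SmoothOff fun y => pd (fun x => energy (K x) y) k x₀ := by
  have h : SmoothOff fun y => fderiv ℝ (fun z : Coord n × Coord n => energy (K z.1) z.2) (x₀, y)
      (EuclideanSpace.single k 1, 0) := by
    intro y hy
    have h1 := ((contDiffAt_energy_prod hK hy).fderiv_right (m := ∞) (by simp)).comp
      (f := fun y => (x₀, y)) y (contDiffAt_const.prodMk contDiffAt_id)
    exact h1.clm_apply contDiffAt_const
  exact h.congr fun y hy =>
    pd_eq_fderiv_prod ((contDiffAt_energy_prod hK hy).differentiableAt (by simp)) k

theorem smoothOff_spray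
    (hK : ∀ y, y ≠ 0 → ContDiffAt ℝ ∞ (fun z : Coord n × Coord n => K z.1 z.2) (x₀, y))
    (hE : IsMinkowskiEnergy (energy (K x₀))) (l : Fin n) : SmoothOff (spray K l x₀) := by
  refine (SmoothOff.const _).mul (SmoothOff.sum _ fun m _ =>
    (smoothOff_inv (smoothOff_gMatrix hE.smooth) (fun _ hy => det_gMatrix_ne_zero hE hy) l m).mul
      (SmoothOff.sub (SmoothOff.sum _ fun k _ => (SmoothOff.coord k).mul ?_)
        (smoothOff_pd_energy hK m)))
  exact (smoothOff_pd_energy hK k).pd m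

theorem energy_const_mul (c : ℝ) (L : Coord n → ℝ) :
    energy (fun y => c * L y) = fun y => c ^ 2 * energy L y := by
  ext y
  simp only [energy]
  ring

theorem pd_const_mul (c : ℝ) (f : Coord n → ℝ) (i : Fin n) :
    pd (fun y => c * f y) i = fun y => c * pd f i y := by
  ext y
  have h := congrFun (fderiv_const_smul_field (𝕜 := ℝ) (f := f) c) y
  change fderiv ℝ (c • f) y _ = _
  rw [h]
  rfl

theorem gMatrix_const_mul (c : ℝ) (L : Coord n → ℝ) (y : Coord n) :
    gMatrix (fun y => c * L y) y = c ^ 2 • gMatrix L y := by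
  ext i j
  simp only [gMatrix, energy_const_mul, pd_const_mul, Matrix.of_apply, Matrix.smul_apply,
    smul_eq_mul]

/-- The change of the spray coefficients under a conformal change of the metric. -/
theorem spray_conformal
    (hK : ∀ y, y ≠ 0 → ContDiffAt ℝ ∞ (fun z : Coord n × Coord n => K z.1 z.2) (x₀, y))
    (hE : IsMinkowskiEnergy (energy (K x₀))) {β : Coord n → ℝ} (hβ : DifferentiableAt ℝ β x₀)
    (l : Fin n) {y : Coord n} (hy : y ≠ 0) :
    spray (fun x y => Real.exp (β x) * K x y) l x₀ y = spray K l x₀ y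
      + (y l * linForm (fun k => pd β k x₀) y
        - energy (K x₀) y * gradX (K x₀) (fun k => pd β k x₀) l y) := by
  set a : Fin n → ℝ := fun k => pd β k x₀ with ha
  set c : ℝ := Real.exp (β x₀) with hc
  have hc0 : c ≠ 0 := (Real.exp_pos _).ne'
  have h1 : ∀ y', y' ≠ 0 → ∀ k, pd (fun x => energy (fun y => Real.exp (β x) * K x y) y') k x₀
      = c ^ 2 * (2 * a k * energy (K x₀) y' + pd (fun x => energy (K x) y') k x₀) := by
    intro y' hy' k
    have hd : DifferentiableAt ℝ (fun x => energy (K x) y') x₀ :=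
      ((contDiffAt_energy_prod hK hy').comp (f := fun x => (x, y')) x₀
        (contDiffAt_id.prodMk contDiffAt_const)).differentiableAt (by simp)
    have h := ((hβ.hasFDerivAt.exp.pow 2).mul hd.hasFDerivAt)
    simp only [energy_const_mul]
    unfold pd
    change fderiv ℝ ((fun x => Real.exp (β x) ^ 2) * fun x => energy (K x) y') x₀ _ = _
    erw [h.fderiv]
    simp [ha, pd, ← hc]
    ring
  have h2 : ∀ k m, pd (fun y' => pd (fun x => energy (fun y => Real.exp (β x) * K x y) y') k x₀) m y
      = c ^ 2 * (2 * a k * pd (energy (K x₀)) m y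
        + pd (fun y' => pd (fun x => energy (K x) y') k x₀) m y) := by
    intro k m
    rw [pd_congr (fun y' hy' => h1 y' hy' k) m y hy, pd_const_mul]
    beta_reduce
    rw [pd_add ((SmoothOff.const _).mul hE.smooth) (smoothOff_pd_energy hK k) m y hy, pd_const_mul]
  have hinv : (gMatrix (fun y => c * K x₀ y) y)⁻¹ = (c ^ 2)⁻¹ • (gMatrix (K x₀) y)⁻¹ := by
    rw [gMatrix_const_mul]
    have hu : IsUnit (gMatrix (K x₀) y).det := isUnit_iff_ne_zero.2 (det_gMatrix_ne_zero hE hy)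
    refine Matrix.inv_eq_left_inv ?_
    rw [Matrix.smul_mul, Matrix.mul_smul, Matrix.nonsing_inv_mul _ hu, smul_smul,
      inv_mul_cancel₀ (pow_ne_zero 2 hc0), one_smul]
  have h3 : ∀ m, (∑ k, y k * (c ^ 2 * (2 * a k * pd (energy (K x₀)) m y
        + pd (fun y' => pd (fun x => energy (K x) y') k x₀) m y)))
      = c ^ 2 * (2 * linForm a y * pd (energy (K x₀)) m y
        + ∑ k, y k * pd (fun y' => pd (fun x => energy (K x) y') k x₀) m y) := by
    intro m
    rw [linForm_apply, Finset.mul_sum, Finset.sum_mul, ← Finset.sum_add_distrib, Finset.mul_sum]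
    exact Finset.sum_congr rfl fun k _ => by ring
  unfold spray
  -- Writing $y^l=g^{lm}\,\partial E/\partial y^m$ puts both sides under one sum over `m`; the
  -- factors $e^{2\beta}$ and $e^{-2\beta}$ then cancel termwise.
  rw [← sum_inv_mul_pd_energy hE hy l]
  simp only [h2, h1 y hy, h3]
  change 1 / 2 * ∑ m, (gMatrix (fun y => c * K x₀ y) y)⁻¹ l m * _ = _
  rw [hinv]
  simp only [Matrix.smul_apply, smul_eq_mul, gradX]
  rw [Finset.mul_sum, Finset.mul_sum, Finset.mul_sum, Finset.sum_mul, ← Finset.sum_sub_distrib,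
    ← Finset.sum_add_distrib]
  refine Finset.sum_congr rfl fun m _ => ?_
  field_simp
  ring

theorem isMinkowskiEnergy_energy
    (hK : ∀ y, y ≠ 0 → ContDiffAt ℝ ∞ (fun z : Coord n × Coord n => K z.1 z.2) (x₀, y))
    (hhom : ∀ y, ∀ t : ℝ, 0 < t → K x₀ (t • y) = t * K x₀ y)
    (hpos : ∀ y, y ≠ 0 → (gMatrix (K x₀) y).PosDef) : IsMinkowskiEnergy (energy (K x₀)) where
  smooth := smoothOff_energy hK
  homogeneous y _ t ht := by
    simp only [energy, hhom y t ht]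
    ring
  posDef y hy := (gMatrix_posDef_iff (smoothOff_energy hK) hy).1 (hpos y hy)

/-- If a conformal change does not alter the contracted mixed curvature, then
`E * a(X)` is a quadratic form. -/
theorem exists_quadratic_of_mixedCurvature_eq (hn : 2 ≤ n)
    (hK : ∀ y, y ≠ 0 → ContDiffAt ℝ ∞ (fun z : Coord n × Coord n => K z.1 z.2) (x₀, y))
    (hE : IsMinkowskiEnergy (energy (K x₀))) {β : Coord n → ℝ} (hβ : DifferentiableAt ℝ β x₀)
    {a : Fin n → ℝ} (ha : a = fun k => pd β k x₀)
    (hP : ∀ y, y ≠ 0 → ∀ i j k,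
      ∑ l, mixedCurvature (fun x y => Real.exp (β x) * K x y) l i j k x₀ y * a l
        = ∑ l, mixedCurvature K l i j k x₀ y * a l) :
    ∃ q : Coord n →L[ℝ] Coord n →L[ℝ] ℝ, (∀ u v, q u v = q v u) ∧
      ∀ y, y ≠ 0 → energy (K x₀) y * linForm a (gradVec (K x₀) a y) = q y y := by
  have hX := isGradient_gradVec hE a
  set D : Fin n → Coord n → ℝ := fun l y =>
    y l * linForm a y - energy (K x₀) y * gradX (K x₀) a l y with hD
  have hDs : ∀ l, SmoothOff (D l) := fun l =>
    ((SmoothOff.coord l).mul fun y _ => (linForm a).contDiff.contDiffAt).sub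
      (hE.smooth.mul (smoothOff_gradX hE a l))
  have hGs : ∀ l, SmoothOff (spray K l x₀) := smoothOff_spray hK hE
  have hadd : ∀ l i j k, ∀ y, y ≠ 0 →
      mixedCurvature (fun x y => Real.exp (β x) * K x y) l i j k x₀ y
        = mixedCurvature K l i j k x₀ y - pd (pd (pd (D l) i) j) k y := by
    intro l i j k y hy
    have e0 : ∀ y, y ≠ 0 → spray (fun x y => Real.exp (β x) * K x y) l x₀ y
        = spray K l x₀ y + D l y := fun y hy => by
      rw [spray_conformal hK hE hβ l hy, hD, ha]
    have e1 := fun y hy => (pd_congr e0 i y hy).trans (pd_add (hGs l) (hDs l) i y hy)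
    have e2 := fun y hy => (pd_congr e1 j y hy).trans
      (pd_add ((hGs l).pd i) ((hDs l).pd i) j y hy)
    have e3 := fun y hy => (pd_congr e2 k y hy).trans
      (pd_add (((hGs l).pd i).pd j) (((hDs l).pd i).pd j) k y hy)
    unfold mixedCurvature
    rw [e3 y hy]
    ring
  set f : Coord n → ℝ := fun y => ∑ l, D l y * a l with hf
  have hfs : SmoothOff f := SmoothOff.sum _ fun l _ => (hDs l).mul (SmoothOff.const _)
  -- The contraction with `a` of the change in the spray.
  have hfe : ∀ y, f y = linForm a y ^ 2 - energy (K x₀) y * linForm a (gradVec (K x₀) a y) := by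
    intro y
    rw [← gradSq_eq]
    unfold gradSq
    rw [pow_two, Finset.mul_sum]
    nth_rw 2 [linForm_apply]
    rw [Finset.mul_sum, ← Finset.sum_sub_distrib, hf]
    refine Finset.sum_congr rfl fun l _ => ?_
    rw [hD]
    ring
  have hf3 : ∀ y, y ≠ 0 → fderiv ℝ (fderiv ℝ (fderiv ℝ f)) y = 0 := by
    intro y hy
    have e : ∀ i j k, fderiv ℝ (fderiv ℝ (fderiv ℝ f)) y (EuclideanSpace.single k 1)
        (EuclideanSpace.single j 1) (EuclideanSpace.single i 1) = 0 := by
      intro i j k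
      rw [← hfs.pd_pd_pd_apply i j k hy]
      have e1 := pd_sum_mul hDs a i
      have e2 := fun y hy => (pd_congr e1 j y hy).trans
        (pd_sum_mul (fun l => (hDs l).pd i) a j y hy)
      have e3 := (pd_congr e2 k y hy).trans
        (pd_sum_mul (fun l => ((hDs l).pd i).pd j) a k y hy)
      rw [e3]
      have h := hP y hy i j k
      simp only [hadd _ i j k y hy, sub_mul, Finset.sum_sub_distrib] at h
      linarith
    ext u v w
    rw [map_coord_eq_sum (fderiv ℝ (fderiv ℝ (fderiv ℝ f)) y) u]
    simp only [sum_apply, smul_apply]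
    refine Finset.sum_eq_zero fun k _ => ?_
    rw [map_coord_eq_sum (fderiv ℝ (fderiv ℝ (fderiv ℝ f)) y (EuclideanSpace.single k 1)) v]
    simp only [sum_apply, smul_apply]
    refine smul_eq_zero_of_right _ (Finset.sum_eq_zero fun j _ => ?_)
    rw [map_coord_eq_sum (fderiv ℝ (fderiv ℝ (fderiv ℝ f)) y (EuclideanSpace.single k 1)
      (EuclideanSpace.single j 1)) w]
    refine smul_eq_zero_of_right _ (Finset.sum_eq_zero fun i _ => ?_)
    rw [e, smul_zero]
  have hfh : ∀ y, y ≠ 0 → ∀ t : ℝ, 0 < t → f (t • y) = t ^ 2 * f y := by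
    intro y hy t ht
    have hty : t • y ≠ 0 := smul_ne_zero ht.ne' hy
    have hXt : gradVec (K x₀) a (t • y) = gradVec (K x₀) a y :=
      hE.gradient_smul hX hy ht
    rw [hfe, hfe, hXt, hE.homogeneous y hy t ht, map_smul, smul_eq_mul]
    ring
  obtain ⟨b, hbs, hb⟩ := exists_quadratic_of_third_fderiv_eq_zero (by simp; omega) hfs hfh hf3
  -- Since $b(y,y)=a(y)^2-E\,a(X)$, the form sought is $a\otimes a-b$.
  refine ⟨(linForm a).smulRight (linForm a) - b, fun u v => ?_, fun y hy => ?_⟩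
  · simp [hbs u v, mul_comm]
  · have h := hb y hy
    rw [hfe] at h
    simp only [sub_apply, ContinuousLinearMap.smulRight_apply, smul_apply, smul_eq_mul]
    linarith

/-- Constancy of `a(X)` and `F dX(X)(a)` on the kernel of `a`, in induced coordinates. -/
theorem constant_on_ker_coord (hn : 3 ≤ n)
    (hK : ∀ y, y ≠ 0 → ContDiffAt ℝ ∞ (fun z : Coord n × Coord n => K z.1 z.2) (x₀, y))
    (hnonneg : ∀ y, 0 ≤ K x₀ y)
    (hhom : ∀ y, ∀ t : ℝ, 0 < t → K x₀ (t • y) = t * K x₀ y)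
    (hpos : ∀ y, y ≠ 0 → (gMatrix (K x₀) y).PosDef)
    {β : Coord n → ℝ} (hβ : DifferentiableAt ℝ β x₀)
    {a : Fin n → ℝ} (ha : a = fun k => pd β k x₀) (ha0 : linForm a ≠ 0)
    (hP : ∀ y, y ≠ 0 → ∀ i j k,
      ∑ l, mixedCurvature (fun x y => Real.exp (β x) * K x y) l i j k x₀ y * a l
        = ∑ l, mixedCurvature K l i j k x₀ y * a l) :
    (∃ c : ℝ, ∀ y, y ≠ 0 → linForm a y = 0 → gradSq (K x₀) a y = c) ∧
    (∃ c : ℝ, ∀ y, y ≠ 0 → linForm a y = 0 → K x₀ y * gradDeriv (K x₀) a y = c) := by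
  have hE := isMinkowskiEnergy_energy hK hhom hpos
  obtain ⟨q, hqs, hq⟩ := exists_quadratic_of_mixedCurvature_eq (by omega) hK hE hβ ha hP
  obtain ⟨⟨c₁, h₁⟩, ⟨c₂, h₂⟩⟩ :=
    hE.constant_on_ker (by simpa using hn) (isGradient_gradVec hE a) ha0 hqs hq
  refine ⟨⟨c₁, fun y hy hay => ?_⟩, ⟨c₂, fun y hy hay => ?_⟩⟩
  · rw [gradSq_eq, h₁ y hy hay]
  · rw [gradDeriv_eq hE a hy, ← h₂ y hy hay]
    congr 1
    -- Nonnegativity of $F$ identifies it with $\sqrt{2E}$.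
    have : 2 * energy (K x₀) y = K x₀ y ^ 2 := by simp only [energy]; ring
    rw [this, Real.sqrt_sq (hnonneg y)]

end Conformal

/-! ### From the tangent bundle to induced coordinates. -/

section Charts

/-- Carries strong convexity from the tangent space's own identification with $\mathbb R^n$ to the
one given by an arbitrary chart. -/
theorem hess_comp_linear {n : ℕ} {e : Coord n → ℝ} (he : SmoothOff e) (A : Coord n ≃L[ℝ] Coord n)
    {y : Coord n} (hy : y ≠ 0) (v : Coord n) :
    fderiv ℝ (fderiv ℝ (fun y => e (A y))) y v v
      = fderiv ℝ (fderiv ℝ e) (A y) (A v) (A v) := by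
  have hA : ∀ z, z ≠ 0 → A z ≠ 0 := fun z hz => (map_ne_zero_iff _ A.injective).2 hz
  have h1 : fderiv ℝ (fun y => e (A y)) =ᶠ[nhds y]
      fun z => (fderiv ℝ e (A z)).comp (A : Coord n →L[ℝ] Coord n) := by
    filter_upwards [isOpen_ne.eventually_mem hy] with z hz
    exact ((he.hasFDerivAt (hA z hz)).comp z A.hasFDerivAt).fderiv
  have h2 := (((he.fderiv.hasFDerivAt (hA y hy)).comp y A.hasFDerivAt).clm_comp
    (hasFDerivAt_const (A : Coord n →L[ℝ] Coord n) y)).fderiv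
  rw [h1.fderiv_eq]
  erw [h2]
  simp

variable {n : ℕ} {M : Type*} [TopologicalSpace M] [ChartedSpace (Coord n) M]
  {φ : OpenPartialHomeomorph M (Coord n)}

theorem mdifferentiable_chart (hφ : φ ∈ IsManifold.maximalAtlas (𝓡 n) ∞ M) :
    φ.MDifferentiable (𝓡 n) (𝓡 n) :=
  ⟨(contMDiffOn_of_mem_maximalAtlas hφ).mdifferentiableOn (by simp),
    (contMDiffOn_symm_of_mem_maximalAtlas hφ).mdifferentiableOn (by simp)⟩

/-- The derivative of the inverse of a chart, as a linear isomorphism of `ℝⁿ`. -/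
noncomputable def chartSymmDeriv (hφ : φ ∈ IsManifold.maximalAtlas (𝓡 n) ∞ M) {x : Coord n}
    (hx : x ∈ φ.target) : Coord n ≃L[ℝ] Coord n :=
  (mdifferentiable_chart hφ).symm.mfderiv hx

theorem linForm_dCoords (hφ : φ ∈ IsManifold.maximalAtlas (𝓡 n) ∞ M) {α : M → ℝ}
    (hα : ContMDiff (𝓡 n) 𝓘(ℝ, ℝ) ∞ α) {p : M} (hp : p ∈ φ.source)
    (v : TangentSpace (𝓡 n) p) :
    linForm (dCoords φ α p) (vecCoords φ p v) = mfderiv (𝓡 n) 𝓘(ℝ, ℝ) α p v := by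
  have hd := mdifferentiable_chart hφ
  have hβ : MDifferentiableAt (𝓡 n) 𝓘(ℝ, ℝ) (α ∘ φ.symm) (φ p) :=
    (hα.mdifferentiable (by simp) _).comp _ (hd.mdifferentiableAt_symm (φ.map_source hp))
  have h1 : α =ᶠ[nhds p] (α ∘ φ.symm) ∘ φ := by
    filter_upwards [φ.open_source.mem_nhds hp] with z hz
    simp [φ.left_inv hz]
  have h2 := DFunLike.congr_fun (h1.mfderiv_eq (I := 𝓡 n) (I' := 𝓘(ℝ, ℝ))) v
  rw [mfderiv_comp p hβ (hd.mdifferentiableAt hp)] at h2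
  refine Eq.trans ?_ h2.symm
  change _ = mfderiv (𝓡 n) 𝓘(ℝ, ℝ) (α ∘ φ.symm) (φ p) (vecCoords φ p v)
  rw [mfderiv_eq_fderiv, linForm_apply]
  refine Eq.trans ?_ (map_coord_eq_sum (fderiv ℝ (α ∘ φ.symm) (φ p)) (vecCoords φ p v)).symm
  exact Finset.sum_congr rfl fun l _ => by rw [smul_eq_mul, mul_comm]; rfl

theorem inCoords_vecCoords (hφ : φ ∈ IsManifold.maximalAtlas (𝓡 n) ∞ M)
    (F : TangentBundle (𝓡 n) M → ℝ) {p : M} (hp : p ∈ φ.source) (v : TangentSpace (𝓡 n) p) :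
    inCoords φ F (φ p) (vecCoords φ p v) = F ⟨p, v⟩ := by
  have h : ∀ (q : M) (w : Coord n), q = p → w = v → F ⟨q, w⟩ = F ⟨p, v⟩ := by
    rintro q w rfl rfl
    rfl
  refine h _ _ (φ.left_inv hp) ?_
  exact DFunLike.congr_fun ((mdifferentiable_chart hφ).symm_comp_deriv hp) v

variable [IsManifold (𝓡 n) ∞ M]

theorem inCoords_eq_fiber (hφ : φ ∈ IsManifold.maximalAtlas (𝓡 n) ∞ M)
    (F : TangentBundle (𝓡 n) M → ℝ) {x : Coord n} (hx : x ∈ φ.target) (y : Coord n) :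
    inCoords φ F x y = fiber F (φ.symm x) (chartSymmDeriv hφ hx y) :=
  rfl

/-- The coordinate expression is $F$ composed with the tangent map of `φ.symm`, which is smooth and
preserves nonzero vectors. -/
theorem contDiffAt_inCoords (hφ : φ ∈ IsManifold.maximalAtlas (𝓡 n) ∞ M)
    {F : TangentBundle (𝓡 n) M → ℝ} (hF : IsFinslerMetric F) {x : Coord n} (hx : x ∈ φ.target)
    {y : Coord n} (hy : y ≠ 0) :
    ContDiffAt ℝ ∞ (fun z : Coord n × Coord n => inCoords φ F z.1 z.2) (x, y) := by
  have h1 : ContMDiffOn (𝓡 n).tangent (𝓡 n).tangent ∞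
      (tangentMapWithin (𝓡 n) (𝓡 n) φ.symm φ.target)
      (Bundle.TotalSpace.proj ⁻¹' φ.target) :=
    (contMDiffOn_symm_of_mem_maximalAtlas hφ).contMDiffOn_tangentMapWithin (by simp)
      φ.open_target.uniqueMDiffOn
  let S : Set (Coord n × Coord n) := {z | z.1 ∈ φ.target ∧ z.2 ≠ 0}
  have hS : IsOpen S := (φ.open_target.preimage continuous_fst).inter
    (isOpen_ne.preimage continuous_snd)
  let e : Coord n × Coord n → TangentBundle (𝓡 n) (Coord n) := fun z => ⟨z.1, z.2⟩
  have he : ContMDiff 𝓘(ℝ, Coord n × Coord n) (𝓡 n).tangent ∞ e := by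
    have h := contMDiff_tangentBundleModelSpaceHomeomorph_symm (I := 𝓡 n) (n := ∞)
    have h' : ContMDiff 𝓘(ℝ, Coord n × Coord n) ((𝓡 n).prod 𝓘(ℝ, Coord n)) ∞
        fun z : Coord n × Coord n => (z.1, z.2) :=
      contDiff_fst.contMDiff.prodMk contDiff_snd.contMDiff
    -- Identifies the product charted-space structure on $\mathbb R^n\times\mathbb R^n$ with its
    -- structure as a model space.
    rw [chartedSpaceSelf_prod] at h'
    exact h.comp h'
  have h2 : ContMDiffOn 𝓘(ℝ, Coord n × Coord n) 𝓘(ℝ, ℝ) ∞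
      (F ∘ tangentMapWithin (𝓡 n) (𝓡 n) φ.symm φ.target ∘ e) S := by
    refine hF.smooth.comp (h1.comp he.contMDiffOn fun z hz => hz.1) fun z hz => ?_
    have e1 : (tangentMapWithin (𝓡 n) (𝓡 n) φ.symm φ.target (e z)).2
        = chartSymmDeriv hφ hz.1 z.2 := by
      change mfderivWithin (𝓡 n) (𝓡 n) φ.symm φ.target z.1 z.2 = _
      rw [mfderivWithin_of_isOpen φ.open_target hz.1]
      rfl
    change (tangentMapWithin (𝓡 n) (𝓡 n) φ.symm φ.target (e z)).2 ≠ 0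
    rw [e1]
    exact (map_ne_zero_iff _ (chartSymmDeriv hφ hz.1).injective).2 hz.2
  have h3 := (contMDiffOn_iff_contDiffOn.1 h2).contDiffAt (hS.mem_nhds (x := (x, y)) ⟨hx, hy⟩)
  refine h3.congr_of_eventuallyEq ?_
  filter_upwards [hS.mem_nhds (x := (x, y)) ⟨hx, hy⟩] with z hz
  change F ⟨_, _⟩ = F ⟨φ.symm z.1, mfderivWithin (𝓡 n) (𝓡 n) φ.symm φ.target z.1 z.2⟩
  rw [mfderivWithin_of_isOpen φ.open_target hz.1]

theorem gMatrix_inCoords_posDef (hφ : φ ∈ IsManifold.maximalAtlas (𝓡 n) ∞ M)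
    {F : TangentBundle (𝓡 n) M → ℝ} (hF : IsFinslerMetric F) {x : Coord n} (hx : x ∈ φ.target)
    {y : Coord n} (hy : y ≠ 0) : (gMatrix (inCoords φ F x) y).PosDef := by
  set A := chartSymmDeriv hφ hx
  have hs : SmoothOff (energy (inCoords φ F x)) :=
    smoothOff_energy fun y hy => contDiffAt_inCoords hφ hF hx hy
  have hfib : SmoothOff (energy (fiber F (φ.symm x))) := by
    intro z hz
    have h := (hs (A.symm z) ((map_ne_zero_iff _ A.symm.injective).2 hz)).comp z
      A.symm.contDiff.contDiffAt
    convert h using 1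
    ext w
    simp [energy, inCoords_eq_fiber hφ F hx, A]
  have hA : ∀ z, z ≠ 0 → A z ≠ 0 := fun z hz => (map_ne_zero_iff _ A.injective).2 hz
  rw [gMatrix_posDef_iff hs hy]
  intro v hv
  have h := (gMatrix_posDef_iff hfib (hA y hy)).1 (hF.strongly_convex _ _ (hA y hy)) _ (hA v hv)
  rw [← hess_comp_linear hfib A hy] at h
  exact h

end Charts

end FinslerConformal

/-! ### The theorem on the manifold. -/

theorem theorem5 {n : ℕ} (hn : 3 ≤ n) {M : Type*} [TopologicalSpace M]
    [ChartedSpace (EuclideanSpace ℝ (Fin n)) M] [IsManifold (𝓡 n) ∞ M]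
    (F : TangentBundle (𝓡 n) M → ℝ) (hF : IsFinslerMetric F)
    (α : M → ℝ) (hα : ContMDiff (𝓡 n) 𝓘(ℝ, ℝ) ∞ α)
    (p : M) (hp : mfderiv (𝓡 n) 𝓘(ℝ, ℝ) α p ≠ 0)
    -- local coordinates around `p`
    (φ : OpenPartialHomeomorph M (EuclideanSpace ℝ (Fin n)))
    (hφ : φ ∈ IsManifold.maximalAtlas (𝓡 n) ∞ M) (hpφ : p ∈ φ.source)
    -- the indicatrix at `p` has positive sectional curvature
    (hcurv : IndicatrixPositivelyCurved (inCoords φ F (φ p)))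
    -- the contracted mixed curvatures of `e^α F` and `F` agree on the nonzero vectors at `p`
    (hP : ∀ v : TangentSpace (𝓡 n) p, v ≠ 0 → ∀ i j k : Fin n,
      ∑ l, mixedCurvature (inCoords φ (conformal α F)) l i j k (φ p) (vecCoords φ p v)
          * dCoords φ α p l
        = ∑ l, mixedCurvature (inCoords φ F) l i j k (φ p) (vecCoords φ p v)
          * dCoords φ α p l) :
    (∃ c : ℝ, ∀ v : TangentSpace (𝓡 n) p, v ≠ 0 → mfderiv (𝓡 n) 𝓘(ℝ, ℝ) α p v = 0 →
      gradSq (inCoords φ F (φ p)) (dCoords φ α p) (vecCoords φ p v) = c) ∧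
    (∃ c : ℝ, ∀ v : TangentSpace (𝓡 n) p, v ≠ 0 → mfderiv (𝓡 n) 𝓘(ℝ, ℝ) α p v = 0 →
      F ⟨p, v⟩ * gradDeriv (inCoords φ F (φ p)) (dCoords φ α p) (vecCoords φ p v) = c) := by
  have hx : φ p ∈ φ.target := φ.map_source hpφ
  have hd := mdifferentiable_chart hφ
  have hlin := linForm_dCoords hφ hα hpφ
  have hne : ∀ v : TangentSpace (𝓡 n) p, v ≠ 0 → vecCoords φ p v ≠ 0 := fun v hv =>
    (map_ne_zero_iff (mfderiv (𝓡 n) (𝓡 n) φ p) (hd.mfderiv_injective hpφ)).2 hv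
  have ha0 : linForm (dCoords φ α p) ≠ 0 := by
    intro h
    refine hp (ContinuousLinearMap.ext fun v => ?_)
    rw [← hlin v, h]
    rfl
  have hβ : DifferentiableAt ℝ (fun x => α (φ.symm x)) (φ p) :=
    ((hα.mdifferentiable (by simp) _).comp _ (hd.mdifferentiableAt_symm hx)).differentiableAt
  -- Every coordinate vector comes from a tangent vector at `p`, and `conformal α F` in coordinates
  -- unfolds to the displayed product.
  have hP' : ∀ y : Coord n, y ≠ 0 → ∀ i j k,
      ∑ l, mixedCurvature (fun x y => Real.exp (α (φ.symm x)) * inCoords φ F x y) l i j k (φ p) y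
          * dCoords φ α p l
        = ∑ l, mixedCurvature (inCoords φ F) l i j k (φ p) y * dCoords φ α p l := by
    intro y hy i j k
    obtain ⟨v, rfl⟩ := hd.mfderiv_surjective hpφ y
    exact hP v (fun h => hy (by rw [h]; exact map_zero _)) i j k
  obtain ⟨⟨c₁, h₁⟩, ⟨c₂, h₂⟩⟩ := constant_on_ker_coord hn
    (fun y hy => contDiffAt_inCoords hφ hF hx hy) (fun y => hF.nonneg _)
    (fun y t ht => by
      rw [inCoords_eq_fiber hφ F hx, inCoords_eq_fiber hφ F hx, map_smul]
      exact hF.homogeneous _ _ t ht)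
    (fun y hy => gMatrix_inCoords_posDef hφ hF hx hy) hβ rfl ha0 hP'
  refine ⟨⟨c₁, fun v hv hαv => ?_⟩, ⟨c₂, fun v hv hαv => ?_⟩⟩
  · exact h₁ _ (hne v hv) ((hlin v).trans hαv)
  · rw [← inCoords_vecCoords hφ F hpφ v]
    exact h₂ _ (hne v hv) ((hlin v).trans hαv)
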